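/- **Setting.** All trees $T=(V,E)$ are finite with at least two nodes. A *search schedule* on $T$ is a finite sequence of moves $S(1),\dots,S(t_{fin})$; each move places a new searcher on a node $v$ (written $0\to v$), or slides a searcher along an edge from a node $u$, where a searcher is located, to a neighbor $v$ ($u\to v$), or removes a searcher from a node ($u\to 0$). At time $0$ there are no searchers in the graph; time $t$ is the moment after the $t$-th move. A node is *guarded* at time $t$ if a searcher is located on it. $\overline{sn}(S)$ is the maximum over $t$ of the number of searchers inside the graph. *Node game.* At time $0$ all nodes are n-dirty. An n-dirty node becomes n-clear when it is occupied by a searcher; an n-clear node becomes n-dirty when it is connected to an n-dirty node by a path all of whose nodes (ends included) are unguarded. An edge is n-clear iff both its ends are n-clear. *Edge game.* At time $0$ all edges are e-dirty. An e-dirty edge becomes e-clear when a searcher slides along it; an e-clear edge becomes e-dirty when it is the first edge of a path whose last edge is e-dirty and whose interior nodes are all unguarded. (An edge that is cleared and recontaminated by the same move is e-dirty after this move.) A node is e-dirty iff it is unguarded and incident to an e-dirty edge. The clear graph of either game at time $t$ consists of the clear nodes and the clear edges. A schedule is *node (edge) clearing* if all nodes (edges) are n-clear (e-clear) at its end; *internal*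 if it never removes a searcher; *monotone* in the node (edge) game if the set of n-clear nodes (e-clear edges) never loses an element; *connected* in a game if the clear graph is connected at all times $t\ge 1$; *IMC* if it is internal, and monotone and connected in the game considered; *rooted* at $u_0$ if searchers are placed only on $u_0$. Let $s_E^{imc}(T)$ (resp. $s_N^{imc}(T)$) be the least $\overline{sn}(S)$ over all, not necessarily rooted, IMC edge-clearing (resp. node-clearing) schedules $S$ of $T$; such a schedule is *minimal* if it attains this value. *The algorithm* **Search**. For a finite family of positive integers $a_1\ge a_2\ge\dots\ge a_K$ put $c()=1$, $c(a_1)=a_1$, and $c(a_1,\dots,a_K)=\max(a_1,a_2+1)$ if $K\ge 2$. Label every directed edge $(x,y)$ of $T$ recursively by $\lambda_x(xy)=c\big(\lambda_y(yz):z\text{ a neighbor of }y,\ z\ne x\big)$, and put $\mu(x)=c\big(\lambda_x(xy): y \text{ a neighbor of } x\big)$. **Search** chooses a node $u_0$ with the least $\mu$, performs $\mu(u_0)$ times the move $0\to u_0$, and then, for the neighbors $y$ of $u_0$ in increasing order of $\lambda_{u_0}(u_0y)$, executes $\mathbf{Move}(u_0,y,\lambda_{u_0}(u_0y))$. Here $\mathbf{Move}(u,v,J)$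 performs $J$ times the move $u\to v$, then executes $\mathbf{Move}(v,w,\lambda_v(vw))$ for the neighbors $w\ne u$ of $v$ in increasing order of $\lambda_v(vw)$, and then performs $J$ times the move $v\to u$. Ties, in the choice of $u_0$ and in the orders, are broken arbitrarily. **Theorem.** For every tree $T$ (finite, with at least two nodes), **Search** produces a schedule, and every schedule $S$ that **Search** can produce, with starting node $u_0$, is rooted at $u_0$ and is both 1. a minimal edge-clearing IMC search of $T$, and 2. a minimal node-clearing IMC search of $T$. Consequently $s_E^{imc}(T)=s_N^{imc}(T)$ for every tree $T$. -/

import Mathlib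

namespace GraphSearch

/-! ## Search schedules -/

/-- A move of a search schedule. `place v` is the move `0 → v`, `slide u v` is the move `u → v`
along an edge and `remove u` is the move `u → 0`, where `0` is the fictitious source node in which
the unused searchers are kept. -/
inductive SearchMove (V : Type*) where
  | place (v : V)
  | slide (u v : V)
  | remove (u : V)

section Schedules

variable {V : Type*} [DecidableEq V]

/-- The number of searchers at every node after a move, given these numbers before the move. -/
def SearchMove.apply : SearchMove V → (V → ℕ) → V → ℕ
  | .place v, c => fun w => if w = v then c w + 1 else c w
  | .slide u v, c => fun w => if w = u then c w - 1 else if w = v then c w + 1 else c w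
  | .remove u, c => fun w => if w = u then c w - 1 else c w

/-- A move can be performed in the configuration `c`: a searcher can slide only along an edge, and
a searcher can leave a node only if there is one at that node. -/
def SearchMove.Legal (G : SimpleGraph V) : SearchMove V → (V → ℕ) → Prop
  | .place _, _ => True
  | .slide u v, c => G.Adj u v ∧ 0 < c u
  | .remove u, c => 0 < c u

/-- `occ S t v` is the number of searchers at the node `v` at time `t`, i.e. after the first `t`
moves of `S` (there are no searchers in the graph at time `0`). -/
def occ (S : List (SearchMove V)) (t : ℕ) : V → ℕ :=
  (S.take t).foldl (fun c m => m.apply c) (fun _ => 0)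

/-- `S` is a search schedule on `G`. -/
def IsSchedule (G : SimpleGraph V) (S : List (SearchMove V)) : Prop :=
  ∀ (t : ℕ) (ht : t < S.length), (S[t]).Legal G (occ S t)

/-- The number of searchers inside the graph at time `t`. -/
def sn [Fintype V] (S : List (SearchMove V)) (t : ℕ) : ℕ := ∑ v, occ S t v

/-- The maximum number of searchers used by `S`. -/
def maxSn [Fintype V] (S : List (SearchMove V)) : ℕ :=
  (Finset.range (S.length + 1)).sup (sn S)

/-- Searchers are placed only into the root `u₀`. -/
def IsRooted (u₀ : V) (S : List (SearchMove V)) : Prop :=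
  ∀ v, SearchMove.place v ∈ S → v = u₀

/-- Searchers are never removed (and, by legality, they move only along the edges). -/
def IsInternal (S : List (SearchMove V)) : Prop :=
  ∀ u, SearchMove.remove u ∉ S

/-! ## The node game -/

/-- `u` and `v` are connected by a path all of whose nodes (including `u` and `v`) are unguarded;
the path may consist of a single node. -/
def NUnguardedConn (G : SimpleGraph V) (c : V → ℕ) (u v : V) : Prop :=
  ∃ p : G.Walk u v, p.IsPath ∧ ∀ w ∈ p.support, c w = 0

/-- The set of n-dirty nodes at time `t`. All nodes are n-dirty at time `0`; after a move the
n-dirty nodes are those that were n-dirty and are unguarded, together with all nodes that are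
connected to one of these by an unguarded path. -/
def nDirty (G : SimpleGraph V) (S : List (SearchMove V)) : ℕ → Set V
  | 0 => Set.univ
  | t + 1 => {u | ∃ v ∈ nDirty G S t, NUnguardedConn G (occ S (t + 1)) u v}

/-- The set of n-clear nodes at time `t`. -/
def nClear (G : SimpleGraph V) (S : List (SearchMove V)) (t : ℕ) : Set V := (nDirty G S t)ᶜ

/-- The n-clear graph at time `t`: its nodes are the n-clear nodes, its edges are the n-clear
edges, i.e. the edges without an n-dirty end. -/
def nClearGraph (G : SimpleGraph V) (S : List (SearchMove V)) (t : ℕ) :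
    SimpleGraph (nClear G S t) := G.induce (nClear G S t)

def NMonotone (G : SimpleGraph V) (S : List (SearchMove V)) : Prop :=
  ∀ t < S.length, nClear G S t ⊆ nClear G S (t + 1)

def NConnected (G : SimpleGraph V) (S : List (SearchMove V)) : Prop :=
  ∀ t, 1 ≤ t → t ≤ S.length → (nClearGraph G S t).Connected

/-- `S` is an internal monotone connected (IMC) node search schedule that clears all nodes. -/
def IsIMCNodeClearing (G : SimpleGraph V) (S : List (SearchMove V)) : Prop :=
  IsSchedule G S ∧ IsInternal S ∧ NMonotone G S ∧ NConnected G S ∧ nDirty G S S.length = ∅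

/-- The IMC node search number: the least number of searchers with which some (not necessarily
rooted) IMC node search schedule clears `G`. -/
noncomputable def sNimc [Fintype V] (G : SimpleGraph V) : ℕ :=
  sInf {k | ∃ S : List (SearchMove V), IsIMCNodeClearing G S ∧ maxSn S = k}

def IsMinimalIMCNodeClearing [Fintype V] (G : SimpleGraph V) (S : List (SearchMove V)) : Prop :=
  IsIMCNodeClearing G S ∧ maxSn S = sNimc G

/-! ## The edge game -/

/-- The edges `e` and `f` are the first and the last edge of a path all of whose interior nodes
are unguarded; the path may consist of a single edge `e = f`. -/
def EUnguardedConn (G : SimpleGraph V) (c : V → ℕ) (e f : Sym2 V) : Prop :=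
  ∃ (a b : V) (p : G.Walk a b), p.IsPath ∧ 0 < p.length ∧
    e = s(a, p.snd) ∧ f = s(p.penultimate, b) ∧
    ∀ i, 0 < i → i < p.length → c (p.getVert i) = 0

/-- The set consisting of the edge that is traversed by a move, if there is one. -/
def SearchMove.traversed : SearchMove V → Set (Sym2 V)
  | .place _ => ∅
  | .slide u v => {s(u, v)}
  | .remove _ => ∅

/-- The set of e-dirty edges at time `t`. All edges are e-dirty at time `0`; after a move the
e-dirty edges are those that were e-dirty and were not traversed by the move, together with all
edges that are connected to one of these by an e-unguarded path. -/
def eDirty (G : SimpleGraph V) (S : List (SearchMove V)) : ℕ → Set (Sym2 V)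
  | 0 => G.edgeSet
  | t + 1 => {e | ∃ f ∈ eDirty G S t, (∀ m ∈ S[t]?, f ∉ m.traversed) ∧
      EUnguardedConn G (occ S (t + 1)) e f}

/-- The set of e-clear edges at time `t`. -/
def eClear (G : SimpleGraph V) (S : List (SearchMove V)) (t : ℕ) : Set (Sym2 V) :=
  G.edgeSet \ eDirty G S t

/-- The set of e-clear nodes at time `t`: a node is e-dirty if it is unguarded and incident to
an e-dirty edge, and e-clear otherwise. -/
def eClearNodes (G : SimpleGraph V) (S : List (SearchMove V)) (t : ℕ) : Set V :=
  {u | ¬ (occ S t u = 0 ∧ ∃ v, s(u, v) ∈ eDirty G S t)}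

/-- The e-clear graph at time `t`: its nodes are the e-clear nodes, its edges are the e-clear
edges. -/
def eClearGraph (G : SimpleGraph V) (S : List (SearchMove V)) (t : ℕ) :
    SimpleGraph (eClearNodes G S t) where
  Adj a b := s((a : V), (b : V)) ∈ eClear G S t
  symm := ⟨fun a b h => by rwa [Sym2.eq_swap]⟩
  loopless := ⟨fun a h => G.loopless.irrefl (a : V) h.1⟩

def EMonotone (G : SimpleGraph V) (S : List (SearchMove V)) : Prop :=
  ∀ t < S.length, eClear G S t ⊆ eClear G S (t + 1)

def EConnected (G : SimpleGraph V) (S : List (SearchMove V)) : Prop :=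
  ∀ t, 1 ≤ t → t ≤ S.length → (eClearGraph G S t).Connected

/-- `S` is an internal monotone connected (IMC) edge search schedule that clears all edges. -/
def IsIMCEdgeClearing (G : SimpleGraph V) (S : List (SearchMove V)) : Prop :=
  IsSchedule G S ∧ IsInternal S ∧ EMonotone G S ∧ EConnected G S ∧ eDirty G S S.length = ∅

/-- The IMC edge search number: the least number of searchers with which some (not necessarily
rooted) IMC edge search schedule clears `G`. -/
noncomputable def sEimc [Fintype V] (G : SimpleGraph V) : ℕ :=
  sInf {k | ∃ S : List (SearchMove V), IsIMCEdgeClearing G S ∧ maxSn S = k}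

def IsMinimalIMCEdgeClearing [Fintype V] (G : SimpleGraph V) (S : List (SearchMove V)) : Prop :=
  IsIMCEdgeClearing G S ∧ maxSn S = sEimc G

end Schedules

/-! ## The algorithm -/

section Algorithm

variable {V : Type*} [Fintype V] [DecidableEq V] {T : SimpleGraph V} [DecidableRel T.Adj]

/-- For the directed edge `d = (x, y)`: the directed edges `(y, z)`, where `z` runs through the
neighbors of `y` other than `x`. -/
def nextDarts (d : T.Dart) : Finset T.Dart :=
  Finset.univ.filter fun e => e.fst = d.snd ∧ e.snd ≠ d.fst

/-- The directed edges that leave `x`. -/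
def outDarts (T : SimpleGraph V) [DecidableRel T.Adj] (x : V) : Finset T.Dart :=
  Finset.univ.filter fun e => e.fst = x

/-- The number of nodes on the side of `y` of the edge `d = (x, y)`. It is used only to see that
the recursions below terminate. -/
noncomputable def branchSize (d : T.Dart) : ℕ :=
  {w | ∃ p : T.Walk d.snd w, p.IsPath ∧ d.fst ∉ p.support}.ncard

theorem branchSize_lt (hT : T.IsTree) {d e : T.Dart} (h : e ∈ nextDarts d) :
    branchSize e < branchSize d := by
  obtain ⟨⟨⟨x, y⟩, hxy⟩, ⟨⟨y', z⟩, hyz⟩⟩ := d, e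
  simp only [nextDarts, Finset.mem_filter, Finset.mem_univ, true_and] at h
  obtain ⟨rfl, hzx⟩ := h
  simp only at hxy hyz
  apply Set.ncard_lt_ncard _ (Set.toFinite _)
  rw [Set.ssubset_iff_of_subset]
  · refine ⟨y', ⟨SimpleGraph.Walk.nil, by simp, by simpa using hxy.ne⟩, ?_⟩
    rintro ⟨p, -, hp⟩
    exact hp p.end_mem_support
  · rintro w ⟨p, hp, hyp⟩
    refine ⟨SimpleGraph.Walk.cons hyz p, hp.cons hyp, ?_⟩
    simp only [SimpleGraph.Walk.support_cons, List.mem_cons, not_or]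
    refine ⟨hxy.ne, fun hx => hzx ?_⟩
    have h1 : (SimpleGraph.Walk.cons hyz (p.takeUntil x hx)).IsPath :=
      (hp.takeUntil hx).cons fun h => hyp (p.support_takeUntil_subset_support hx h)
    have h2 : (SimpleGraph.Walk.cons hxy.symm SimpleGraph.Walk.nil).IsPath := by
      simpa using hxy.ne'
    have h3 := congrArg SimpleGraph.Walk.snd ((hT.existsUnique_path _ _).unique h1 h2)
    simpa using h3

/-- The combination of a multiset of labels: `1` if there are none, the label itself if there is
one, and `max a₁ (a₂ + 1)` if the labels are `a₁ ≥ a₂ ≥ ⋯`. -/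
def combine (m : Multiset ℕ) : ℕ :=
  match m.sort (· ≥ ·) with
  | [] => 1
  | [a] => a
  | a :: b :: _ => max a (b + 1)

/-- The label `λ_x(xy)` of the directed edge `d = (x, y)`. -/
def label (hT : T.IsTree) (d : T.Dart) : ℕ :=
  combine ((nextDarts d).attach.val.map fun e => label hT e.1)
termination_by branchSize d
decreasing_by exact branchSize_lt hT e.2

/-- The number of searchers `μ(x)` for the starting node `x`. -/
def mu (hT : T.IsTree) (x : V) : ℕ :=
  combine ((outDarts T x).val.map (label hT))

/-- A subroutine that sorts finite sets of directed edges in decreasing order of their labels.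
Ties may be broken in any way. -/
structure Sorter (hT : T.IsTree) where
  sort : Finset T.Dart → List T.Dart
  nodup : ∀ s, (sort s).Nodup
  mem_sort : ∀ s d, d ∈ sort s ↔ d ∈ s
  sorted : ∀ s, (sort s).Pairwise fun d e => label hT e ≤ label hT d

/-- The subroutine `Move(u, v, J)` for `d = (u, v)`: slide `J` searchers from `u` to `v`, then call
the subroutine for the edges from `v` to its neighbors other than `u`, in increasing order of their
labels, with as many searchers as the label says, and then slide `J` searchers from `v` to `u`. -/
def moveAlong (hT : T.IsTree) (σ : Sorter hT) (d : T.Dart) (J : ℕ) : List (SearchMove V) :=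
  List.replicate J (.slide d.fst d.snd) ++
    ((σ.sort (nextDarts d)).reverse.attach.flatMap fun e => moveAlong hT σ e.1 (label hT e.1)) ++
    List.replicate J (.slide d.snd d.fst)
termination_by branchSize d
decreasing_by exact branchSize_lt hT ((σ.mem_sort _ _).1 (List.mem_reverse.1 e.2))

/-- The schedule of the algorithm for the starting node `u₀`: place `μ(u₀)` searchers at `u₀`, and
then call `Move` for the edges from `u₀`, in increasing order of their labels. -/
def searchFrom (hT : T.IsTree) (σ : Sorter hT) (u₀ : V) : List (SearchMove V) :=
  List.replicate (mu hT u₀) (.place u₀) ++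
    (σ.sort (outDarts T u₀)).reverse.flatMap fun d => moveAlong hT σ d (label hT d)

/-- `S` is an output of the `Search` algorithm with the starting node `u₀`. The algorithm chooses
a starting node with the least `μ`; ties in this choice and in sorting may be broken in any way. -/
def IsSearchOutput (hT : T.IsTree) (u₀ : V) (S : List (SearchMove V)) : Prop :=
  (∀ x, mu hT u₀ ≤ mu hT x) ∧ ∃ σ : Sorter hT, S = searchFrom hT σ u₀

end Algorithm

end GraphSearch

/-!
The number of searchers is bounded from below and from above by the same quantity `mu hT r`, where
`r` is the node at which the search starts.

*Lower bound.* In both games the clear nodes of a monotone connected search form, from the start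
of the search on, a growing subtree whose frontier is guarded and in which each node is guarded when
it becomes clear; this is all that `IsSweep` records. In the edge game the start is the moment
just before the first edge becomes clear: until then all searchers stand on a single node. The claim
`IsSweep.exists_hasPeak` is that the branch of each directed edge `d` that points away from the
root holds at least `label hT d` searchers at some time before which it was not clear. If the label
comes from two branches at `d.snd` with labels at least `label hT d - 1`, consider the earlier one
of their two peaks: at this time the other branch is not yet clear or holds searchers itself, so
there is a searcher in the branch of `d` outside of the branch that has its peak
(`IsSweep.succ_label_le_load`). The same argument at the root gives `mu hT r`.

*Upper bound.* If the visited nodes with unvisited neighbors are guarded at all times, and the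
searchers are placed on a single node only, then no recontamination takes place, and the clear graph
of either game is the subgraph induced by the visited nodes (`IsExploration.nClear_eq`,
`IsExploration.eDirty_eq`, `IsExploration.eClearNodes_eq`). The schedules of the algorithm have
this property (`leads_moveAlong`): since the branches at a node are explored in increasing order of
their labels, each branch but the last leaves at least one searcher behind, and when all searchers
enter the last branch, all other neighbors of the node have already been visited.
-/

namespace GraphSearch

/-! ### Branches of a tree -/

section Branches

variable {V : Type*} {T : SimpleGraph V}

/-- The branch of the directed edge `d = (x, y)`: the nodes on the side of `y`, i.e. those that are
reached from `y` by a path that avoids `x`. -/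
def branch (d : T.Dart) : Set V :=
  {w | ∃ p : T.Walk d.snd w, p.IsPath ∧ d.fst ∉ p.support}

theorem mem_branch_of_walk {d : T.Dart} {w : V} (p : T.Walk d.snd w) (h : d.fst ∉ p.support) :
    w ∈ branch d := by
  classical
  exact ⟨p.bypass, p.bypass_isPath, fun h' => h (p.support_bypass_subset_support h')⟩

theorem snd_mem_branch (d : T.Dart) : d.snd ∈ branch d :=
  mem_branch_of_walk .nil (by simp [d.adj.ne])

theorem fst_notMem_branch (d : T.Dart) : d.fst ∉ branch d :=
  fun ⟨p, _, h⟩ => h p.end_mem_support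

/-- The nodes of a path inside a branch all belong to the branch. -/
theorem mem_branch_of_mem_support {d : T.Dart} {w v : V} (p : T.Walk d.snd w)
    (h : d.fst ∉ p.support) (hv : v ∈ p.support) : v ∈ branch d := by
  classical
  exact mem_branch_of_walk (p.takeUntil v hv)
    fun h' => h (p.support_takeUntil_subset_support hv h')

/-- In a tree, the first step of the path from `d.fst` to a node of the branch of `d` is `d`. -/
theorem snd_eq_of_mem_branch (hT : T.IsTree) {d : T.Dart} {w : V} (hw : w ∈ branch d)
    {q : T.Walk d.fst w} (hq : q.IsPath) : q.snd = d.snd := by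
  obtain ⟨p, hp, hx⟩ := hw
  have := (hT.existsUnique_path _ _).unique hq (hp.cons (h := d.adj) hx)
  simp [this]

theorem dart_eq_of_mem_branch (hT : T.IsTree) {d e : T.Dart} (h : d.fst = e.fst) {w : V}
    (hd : w ∈ branch d) (he : w ∈ branch e) : d = e := by
  obtain ⟨⟨x, y⟩, hxy⟩ := d
  obtain ⟨⟨x', z⟩, hxz⟩ := e
  obtain rfl : x = x' := h
  obtain ⟨p, hp, -⟩ := (hT.existsUnique_path x w)
  have h1 := snd_eq_of_mem_branch hT hd hp
  have h2 := snd_eq_of_mem_branch hT he hp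
  simp only at h1 h2
  subst h1
  subst h2
  rfl

/-- The only edge of a tree that leaves a branch is the one that defines it. -/
theorem eq_of_adj_of_mem_branch (hT : T.IsTree) {d : T.Dart} {v w : V} (hv : v ∈ branch d)
    (hw : w ∉ branch d) (hvw : T.Adj v w) : v = d.snd ∧ w = d.fst := by
  obtain ⟨p, hp, hx⟩ := hv
  by_cases hwx : w = d.fst
  · subst hwx
    refine ⟨?_, rfl⟩
    have h1 : (p.concat hvw).IsPath := hp.concat hx hvw
    have h2 : (SimpleGraph.Walk.cons d.adj.symm .nil).IsPath := by simp [d.adj.ne']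
    have h3 := congrArg SimpleGraph.Walk.penultimate ((hT.existsUnique_path _ _).unique h1 h2)
    simpa using h3
  · refine absurd (mem_branch_of_walk (p.concat hvw) ?_) hw
    simp [SimpleGraph.Walk.support_concat, hx, Ne.symm hwx]

variable [Fintype V] [DecidableEq V] [DecidableRel T.Adj]

@[simp] theorem mem_nextDarts {d e : T.Dart} :
    e ∈ nextDarts d ↔ e.fst = d.snd ∧ e.snd ≠ d.fst := by
  simp [nextDarts]

@[simp] theorem mem_outDarts {x : V} {e : T.Dart} : e ∈ outDarts T x ↔ e.fst = x := by
  simp [outDarts]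

theorem branch_subset_of_mem_nextDarts (hT : T.IsTree) {d e : T.Dart} (h : e ∈ nextDarts d) :
    branch e ⊆ branch d := by
  obtain ⟨⟨x, y⟩, hxy⟩ := d
  obtain ⟨⟨y', z⟩, hyz⟩ := e
  simp only [mem_nextDarts] at h
  obtain ⟨rfl, hzx⟩ := h
  intro w hw
  -- the reverse of `d` and `e` leave the same node, so `d.fst` is not in the branch of `e`
  have hx : x ∉ branch (⟨⟨y', z⟩, hyz⟩ : T.Dart) := fun hx => by
    have := dart_eq_of_mem_branch hT (d := ⟨⟨y', x⟩, hxy.symm⟩) (e := ⟨⟨y', z⟩, hyz⟩) rfl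
      (snd_mem_branch _) hx
    exact hzx (congrArg (fun d : T.Dart => d.snd) this).symm
  obtain ⟨p, hp, hy⟩ := hw
  refine mem_branch_of_walk (.cons hyz p) ?_
  simp only [SimpleGraph.Walk.support_cons, List.mem_cons, not_or]
  exact ⟨hxy.ne, fun h => hx (mem_branch_of_mem_support (d := ⟨⟨y', z⟩, hyz⟩) p hy h)⟩

theorem mem_branch_iff (hT : T.IsTree) {d : T.Dart} {w : V} :
    w ∈ branch d ↔ w = d.snd ∨ ∃ e ∈ nextDarts d, w ∈ branch e := by
  constructor
  · rintro ⟨p, hp, hx⟩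
    obtain ⟨⟨x, y⟩, hxy⟩ := d
    cases p with
    | nil => exact .inl rfl
    | @cons _ z _ h q =>
      rw [SimpleGraph.Walk.cons_isPath_iff] at hp
      simp only [SimpleGraph.Walk.support_cons, List.mem_cons, not_or] at hx
      refine .inr ⟨⟨⟨y, z⟩, h⟩, ?_, q, hp.1, hp.2⟩
      simp only [mem_nextDarts, true_and]
      rintro rfl
      exact hx.2 q.start_mem_support
  · rintro (rfl | ⟨e, he, hw⟩)
    · exact snd_mem_branch d
    · exact branch_subset_of_mem_nextDarts hT he hw

theorem exists_outDarts_mem_branch (hT : T.IsTree) {x w : V} (hw : w ≠ x) :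
    ∃ e ∈ outDarts T x, w ∈ branch e := by
  obtain ⟨p, hp, -⟩ := hT.existsUnique_path x w
  cases p with
  | nil => exact absurd rfl hw
  | @cons _ z _ h q =>
    rw [SimpleGraph.Walk.cons_isPath_iff] at hp
    exact ⟨⟨⟨x, z⟩, h⟩, by simp, q, hp.1, hp.2⟩

end Branches

/-! ### Labels -/

section Labels

theorem combine_zero : combine 0 = 1 := by simp [combine]

theorem combine_singleton (a : ℕ) : combine {a} = a := by simp [combine]

/-- A multiset with at least two members splits off its two largest members, on which alone
`combine` depends. -/
theorem exists_combine_eq {m : Multiset ℕ} (h : 2 ≤ m.card) :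
    ∃ a b m', m = a ::ₘ b ::ₘ m' ∧ b ≤ a ∧ (∀ c ∈ m', c ≤ b) ∧ combine m = max a (b + 1) := by
  have hs := m.pairwise_sort (· ≥ ·)
  have hm := m.sort_eq (· ≥ ·)
  have hc := congrArg Multiset.card hm
  rw [Multiset.coe_card] at hc
  unfold combine
  match hl : m.sort (· ≥ ·) with
  | [] => simp [hl] at hc; omega
  | [a] => simp [hl] at hc; omega
  | a :: b :: l =>
    rw [hl] at hs hm
    simp only [List.pairwise_cons, List.mem_cons] at hs
    exact ⟨a, b, l, by rw [← hm]; rfl, hs.1 b (.inl rfl), fun c hc => hs.2.1 c hc, rfl⟩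

theorem le_combine_of_mem {m : Multiset ℕ} {a : ℕ} (h : a ∈ m) : a ≤ combine m := by
  rcases Nat.lt_or_ge m.card 2 with hc | hc
  · have h0 : 0 < m.card := Multiset.card_pos_iff_exists_mem.2 ⟨a, h⟩
    obtain ⟨b, rfl⟩ := Multiset.card_eq_one.1 (by omega : m.card = 1)
    rw [Multiset.mem_singleton.1 h, combine_singleton]
  · obtain ⟨b, c, m', rfl, hbc, hm, he⟩ := exists_combine_eq hc
    rw [he]
    simp only [Multiset.mem_cons] at h
    rcases h with rfl | rfl | h
    · omega
    · omega
    · have := hm a h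
      omega

theorem succ_le_combine {a b : ℕ} {m : Multiset ℕ} (hab : a ≤ b) (h : {a, b} ≤ m) :
    a + 1 ≤ combine m := by
  obtain ⟨m', rfl⟩ := Multiset.le_iff_exists_add.1 h
  obtain ⟨c, d, m'', h', hcd, hm, he⟩ := exists_combine_eq (m := {a, b} + m') (by simp)
  rw [he]
  by_contra! hlt
  have had : d < a ∧ c ≤ a := by omega
  -- otherwise `c` would be the only member that is at least `a`
  have h1 := congrArg (Multiset.countP (a ≤ ·)) h'
  have h2 : Multiset.countP (a ≤ ·) m'' = 0 := by
    rw [Multiset.countP_eq_zero]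
    intro x hx
    have := hm x hx
    omega
  have h3 : ({a, b} : Multiset ℕ) = a ::ₘ b ::ₘ 0 := rfl
  rw [Multiset.countP_add, h3, Multiset.countP_cons, Multiset.countP_cons, Multiset.countP_cons,
    Multiset.countP_cons, h2] at h1
  simp only [le_refl, if_true, hab, Multiset.countP_zero, had.1.not_ge, if_false] at h1
  split_ifs at h1 <;> omega

variable {ι : Type*} [DecidableEq ι]

/-- The reason why a combination of labels is needed: either it is one of the labels, or there are
two members whose labels are at least the combination minus one. -/
theorem combine_map_cases {s : Finset ι} (hs : s.Nonempty) (f : ι → ℕ) :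
    (∃ e ∈ s, combine (s.val.map f) = f e) ∨
      ∃ e₁ ∈ s, ∃ e₂ ∈ s, e₁ ≠ e₂ ∧ combine (s.val.map f) ≤ f e₁ + 1 ∧
        combine (s.val.map f) ≤ f e₂ + 1 := by
  rcases Nat.lt_or_ge s.card 2 with hc | hc
  · have := hs.card_pos
    obtain ⟨e, rfl⟩ := Finset.card_eq_one.1 (by omega : s.card = 1)
    exact .inl ⟨e, by simp, by simp [combine_singleton]⟩
  · obtain ⟨a, b, m', h, hba, hm, he⟩ := exists_combine_eq (m := s.val.map f) (by simpa using hc)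
    obtain ⟨e₁, h1, rfl, h2⟩ := (Multiset.map_eq_cons f s.val _ _).2 h
    obtain ⟨e₂, h3, rfl, h4⟩ := (Multiset.map_eq_cons f _ _ _).2 h2
    rw [Multiset.Nodup.mem_erase_iff s.nodup] at h3
    rcases Nat.lt_or_ge (f e₂) (f e₁) with hlt | hge
    · exact .inl ⟨e₁, h1, by rw [he]; omega⟩
    · exact .inr ⟨e₁, h1, e₂, h3.2, h3.1.symm, by rw [he]; omega, by rw [he]; omega⟩

theorem succ_le_combine_map {s : Finset ι} {f : ι → ℕ} {e₁ e₂ : ι} (h1 : e₁ ∈ s) (h2 : e₂ ∈ s)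
    (hne : e₁ ≠ e₂) (h : f e₁ ≤ f e₂) : f e₁ + 1 ≤ combine (s.val.map f) := by
  refine succ_le_combine h ?_
  have : ({e₁, e₂} : Finset ι) ⊆ s := by
    intro x hx
    simp only [Finset.mem_insert, Finset.mem_singleton] at hx
    rcases hx with rfl | rfl <;> assumption
  have h' := Multiset.map_le_map (f := f) (Finset.val_le_iff.2 this)
  rwa [Finset.insert_val_of_notMem (by simpa using hne)] at h'

variable {V : Type*} [Fintype V] [DecidableEq V] {T : SimpleGraph V} [DecidableRel T.Adj]

theorem label_eq (hT : T.IsTree) (d : T.Dart) :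
    label hT d = combine ((nextDarts d).val.map (label hT)) := by
  rw [label]
  congr 1
  exact Multiset.attach_map_val' (nextDarts d).val (label hT)

theorem label_pos (hT : T.IsTree) (d : T.Dart) : 0 < label hT d := by
  induction h : branchSize d using Nat.strong_induction_on generalizing d with
  | _ n ih =>
    rw [label_eq]
    rcases (nextDarts d).eq_empty_or_nonempty with h0 | ⟨e, he⟩
    · simp [h0, combine_zero]
    · exact (ih _ (h ▸ branchSize_lt hT he) e rfl).trans_le
        (le_combine_of_mem (Multiset.mem_map_of_mem _ he))

end Labels

/-! ### The lower bound -/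

section LowerBound

variable {V : Type*} {T : SimpleGraph V}

/-- What the clear nodes `C` and the numbers `c` of searchers have in common in the two games
during a monotone connected search of `T`, from a time `0` at which only the node `r` is clear to
a time `n` at which all nodes are clear. -/
structure IsSweep (T : SimpleGraph V) (r : V) (n : ℕ) (c : ℕ → V → ℕ) (C : ℕ → Set V) : Prop where
  start : C 0 = {r}
  finish : C n = Set.univ
  mono : ∀ i < n, C i ⊆ C (i + 1)
  conn : ∀ i ≤ n, (T.induce (C i)).Preconnected
  guarded_mem : ∀ i ≤ n, ∀ v, 0 < c i v → v ∈ C i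
  boundary : ∀ i ≤ n, ∀ v w, T.Adj v w → v ∈ C i → w ∉ C i → 0 < c i v
  fresh : ∀ i < n, ∀ v, v ∉ C i → v ∈ C (i + 1) → 0 < c (i + 1) v

variable {r : V} {n : ℕ} {c : ℕ → V → ℕ} {C : ℕ → Set V}

theorem IsSweep.mono_le (h : IsSweep T r n c C) {i j : ℕ} (hij : i ≤ j) (hj : j ≤ n) :
    C i ⊆ C j := by
  induction j, hij using Nat.le_induction with
  | base => exact subset_rfl
  | succ j _ ih => exact (ih (by omega)).trans (h.mono j (by omega))

theorem IsSweep.root_mem (h : IsSweep T r n c C) {i : ℕ} (hi : i ≤ n) : r ∈ C i :=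
  h.mono_le (Nat.zero_le i) hi (by simp [h.start])

/-- A branch is entered through the edge that defines it. -/
theorem IsSweep.fst_mem (h : IsSweep T r n c C) (hT : T.IsTree) {d : T.Dart} (hr : r ∉ branch d)
    {i : ℕ} (hi : i ≤ n) {v : V} (hv : v ∈ branch d) (hvC : v ∈ C i) : d.fst ∈ C i := by
  obtain ⟨p⟩ := h.conn i hi ⟨v, hvC⟩ ⟨r, h.root_mem hi⟩
  obtain ⟨e, -, h1, h2⟩ := p.exists_boundary_dart (Subtype.val ⁻¹' branch d) hv hr
  have := eq_of_adj_of_mem_branch hT h1 h2 e.adj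
  rw [← this.2]
  exact e.snd.2

/-- As long as a branch is not clear while its entrance is, it is guarded from within or from its
entrance. -/
theorem IsSweep.exists_guard (h : IsSweep T r n c C) {d : T.Dart} {i : ℕ} (hi : i ≤ n)
    (hd : d.fst ∈ C i) (hnot : ¬ branch d ⊆ C i) :
    ∃ v, (v = d.fst ∨ v ∈ branch d) ∧ 0 < c i v := by
  obtain ⟨w, ⟨p, hp, hx⟩, hwC⟩ := Set.not_subset.1 hnot
  obtain ⟨e, he, h1, h2⟩ :=
    (SimpleGraph.Walk.cons d.adj p).exists_boundary_dart (C i) hd hwC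
  refine ⟨e.fst, ?_, h.boundary i hi _ _ e.adj h1 h2⟩
  have := SimpleGraph.Walk.dart_fst_mem_support_of_mem_darts _ he
  rw [SimpleGraph.Walk.support_cons, List.mem_cons] at this
  exact this.imp_right fun h' => mem_branch_of_mem_support p hx h'

variable [Fintype V]

/-- The number of searchers on the nodes of `B`. -/
noncomputable def load (c : V → ℕ) (B : Set V) : ℕ := ∑ v, B.indicator c v

theorem load_mono (c : V → ℕ) {A B : Set V} (h : A ⊆ B) : load c A ≤ load c B :=
  Finset.sum_le_sum fun _ _ => Set.indicator_le_indicator_of_subset h (fun _ => Nat.zero_le _) _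

theorem load_univ (c : V → ℕ) : load c Set.univ = ∑ v, c v := by simp [load]

theorem load_union (c : V → ℕ) {A B : Set V} (h : Disjoint A B) :
    load c (A ∪ B) = load c A + load c B := by
  simp only [load, ← Finset.sum_add_distrib]
  exact Finset.sum_congr rfl fun v _ => congrFun (Set.indicator_union_of_disjoint h c) v

theorem le_load (c : V → ℕ) {B : Set V} {v : V} (h : v ∈ B) : c v ≤ load c B := by
  have := Finset.single_le_sum (f := fun v => B.indicator c v) (fun _ _ => Nat.zero_le _)
    (Finset.mem_univ v)
  rwa [Set.indicator_of_mem h] at this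

theorem exists_pos_of_load_pos {c : V → ℕ} {B : Set V} (h : 0 < load c B) :
    ∃ v ∈ B, 0 < c v := by
  obtain ⟨v, -, hv⟩ := Finset.exists_ne_zero_of_sum_ne_zero h.ne'
  exact ⟨v, Set.mem_of_indicator_ne_zero hv, by
    rw [Set.indicator_of_mem (Set.mem_of_indicator_ne_zero hv)] at hv; omega⟩

variable [DecidableEq V] [DecidableRel T.Adj]

/-- At the time `i + 1` the branch of `d` holds at least `label d` searchers, and it was not clear
before. -/
def HasPeak (hT : T.IsTree) (c : ℕ → V → ℕ) (C : ℕ → Set V) (d : T.Dart) (i : ℕ) : Prop :=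
  label hT d ≤ load (c (i + 1)) (branch d) ∧ ¬ branch d ⊆ C i

/-- If two branches at a node have peaks, then at the earlier one there is a searcher outside of
the branch that has this peak. -/
theorem IsSweep.succ_label_le_load (h : IsSweep T r n c C) (hT : T.IsTree) {e₁ e₂ : T.Dart}
    (hfst : e₁.fst = e₂.fst) (hne : e₁ ≠ e₂) (hr : r ∉ branch e₁) {i j : ℕ} (hij : i ≤ j)
    (hj : j < n) (h1 : HasPeak hT c C e₁ i) (h2 : HasPeak hT c C e₂ j) :
    label hT e₁ + 1 ≤ load (c (i + 1)) ({e₁.fst} ∪ (branch e₁ ∪ branch e₂)) := by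
  have hg : ∃ v, (v = e₁.fst ∨ v ∈ branch e₂) ∧ 0 < c (i + 1) v := by
    rcases hij.eq_or_lt with rfl | hlt
    · obtain ⟨v, hv, hc⟩ := exists_pos_of_load_pos ((label_pos hT e₂).trans_le h2.1)
      exact ⟨v, .inr hv, hc⟩
    · obtain ⟨v, hv, hc⟩ := exists_pos_of_load_pos ((label_pos hT e₁).trans_le h1.1)
      have := h.fst_mem hT hr (i := i + 1) (by omega) hv (h.guarded_mem _ (by omega) _ hc)
      rw [hfst] at this ⊢
      exact h.exists_guard (by omega) this
        fun hs => h2.2 (hs.trans (h.mono_le (by omega) (by omega)))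
  obtain ⟨v, hv, hc⟩ := hg
  have hv1 : v ∉ branch e₁ := by
    rcases hv with rfl | hv
    · exact fst_notMem_branch e₁
    · exact fun hv1 => hne (dart_eq_of_mem_branch hT hfst hv1 hv)
  have hle : load (c (i + 1)) (branch e₁ ∪ {v}) ≤
      load (c (i + 1)) ({e₁.fst} ∪ (branch e₁ ∪ branch e₂)) := by
    refine load_mono _ (Set.union_subset (fun w hw => .inr (.inl hw)) ?_)
    rintro _ rfl
    exact hv.imp id Or.inr
  rw [load_union _ (by simpa using hv1)] at hle
  have := h1.1
  have := le_load (c (i + 1)) (Set.mem_singleton v)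
  omega

/-- The step from the branches at `y` to all of them together with `y`: there is a time at which
one of the branches is not yet clear, and immediately after it there are at least as many searchers
as the combination of the labels says. -/
theorem IsSweep.exists_combine_le_load (h : IsSweep T r n c C) (hT : T.IsTree) {y : V}
    {s : Finset T.Dart} (hs : s.Nonempty) (hfst : ∀ e ∈ s, e.fst = y) (hr : ∀ e ∈ s, r ∉ branch e)
    (hpeak : ∀ e ∈ s, ∃ i < n, HasPeak hT c C e i) :
    ∃ e ∈ s, ∃ i < n, ¬ branch e ⊆ C i ∧
      combine (s.val.map (label hT)) ≤
        load (c (i + 1)) {w | w = y ∨ ∃ e ∈ s, w ∈ branch e} := by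
  rcases combine_map_cases hs (label hT) with ⟨e, he, hc⟩ | ⟨e₁, h1, e₂, h2, hne, hc1, hc2⟩
  · obtain ⟨i, hi, hp⟩ := hpeak e he
    refine ⟨e, he, i, hi, hp.2, ?_⟩
    rw [hc]
    exact hp.1.trans (load_mono _ fun w hw => .inr ⟨e, he, hw⟩)
  · have key : ∀ e₁ ∈ s, ∀ e₂ ∈ s, e₁ ≠ e₂ →
        combine (s.val.map (label hT)) ≤ label hT e₁ + 1 → ∀ i j, i ≤ j → j < n →
        HasPeak hT c C e₁ i → HasPeak hT c C e₂ j → ∃ e ∈ s, ∃ i < n, ¬ branch e ⊆ C i ∧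
          combine (s.val.map (label hT)) ≤
            load (c (i + 1)) {w | w = y ∨ ∃ e ∈ s, w ∈ branch e} := by
      intro e₁ h1 e₂ h2 hne hc i j hij hj hp1 hp2
      refine ⟨e₁, h1, i, by omega, hp1.2, hc.trans ?_⟩
      refine (h.succ_label_le_load hT ((hfst e₁ h1).trans (hfst e₂ h2).symm) hne (hr e₁ h1) hij hj
        hp1 hp2).trans (load_mono _ ?_)
      rintro w (hw | hw | hw)
      · exact .inl (hw.trans (hfst e₁ h1))
      · exact .inr ⟨e₁, h1, hw⟩
      · exact .inr ⟨e₂, h2, hw⟩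
    obtain ⟨i, hi, hp1⟩ := hpeak e₁ h1
    obtain ⟨j, hj, hp2⟩ := hpeak e₂ h2
    rcases le_total i j with hij | hij
    · exact key e₁ h1 e₂ h2 hne hc1 i j hij hj hp1 hp2
    · exact key e₂ h2 e₁ h1 hne.symm hc2 j i hij hi hp2 hp1

/-- Each branch that does not contain the starting node has a peak. -/
theorem IsSweep.exists_hasPeak (h : IsSweep T r n c C) (hT : T.IsTree) (d : T.Dart)
    (hr : r ∉ branch d) : ∃ i < n, HasPeak hT c C d i := by
  induction hb : branchSize d using Nat.strong_induction_on generalizing d with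
  | _ m ih =>
    subst hb
    have hset : {w | w = d.snd ∨ ∃ e ∈ nextDarts d, w ∈ branch e} = branch d := by
      ext w
      exact (mem_branch_iff hT).symm
    rcases (nextDarts d).eq_empty_or_nonempty with h0 | hne
    · -- a branch with a single node holds a searcher at the moment when it becomes clear
      have hstart : d.snd ∉ C 0 := by
        rw [h.start]
        rintro rfl
        exact hr (snd_mem_branch d)
      have hex : ∃ i, i ≤ n ∧ d.snd ∈ C i := ⟨n, le_rfl, by simp [h.finish]⟩
      classical
      obtain ⟨hle, hmem⟩ := Nat.find_spec hex
      obtain ⟨i, hi⟩ := Nat.exists_eq_succ_of_ne_zero (n := Nat.find hex)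
        fun h0 => hstart (h0 ▸ hmem)
      have hmin := Nat.find_min hex (m := i) (by omega)
      rw [hi] at hle hmem
      have hnot : d.snd ∉ C i := fun hm => hmin ⟨by omega, hm⟩
      refine ⟨i, by omega, ?_, fun hs => hnot (hs (snd_mem_branch d))⟩
      rw [label_eq, h0]
      simp only [Finset.empty_val, Multiset.map_zero, combine_zero]
      exact (h.fresh i (by omega) _ hnot hmem).trans_le (le_load _ (snd_mem_branch d))
    · have hrs : ∀ e ∈ nextDarts d, r ∉ branch e :=
        fun e he hre => hr (branch_subset_of_mem_nextDarts hT he hre)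
      obtain ⟨e, he, i, hi, hnot, hle⟩ := h.exists_combine_le_load hT hne
        (fun e he => (mem_nextDarts.1 he).1) hrs
        fun e he => ih _ (branchSize_lt hT he) e (hrs e he) rfl
      rw [hset, ← label_eq] at hle
      exact ⟨i, hi, hle, fun hs => hnot ((branch_subset_of_mem_nextDarts hT he).trans hs)⟩

/-- A search that starts at `r` uses at least `μ(r)` searchers. -/
theorem IsSweep.exists_mu_le [Nontrivial V] (h : IsSweep T r n c C) (hT : T.IsTree) :
    ∃ i ≤ n, mu hT r ≤ ∑ v, c i v := by
  obtain ⟨w, hw⟩ := exists_ne r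
  obtain ⟨e, he, -⟩ := exists_outDarts_mem_branch hT hw
  have hrs : ∀ e ∈ outDarts T r, r ∉ branch e := fun e he hre => by
    rw [← mem_outDarts.1 he] at hre
    exact fst_notMem_branch e hre
  obtain ⟨-, -, i, hi, -, hle⟩ := h.exists_combine_le_load hT ⟨e, he⟩
    (fun e he => mem_outDarts.1 he) hrs fun e he => h.exists_hasPeak hT e (hrs e he)
  refine ⟨i + 1, hi, hle.trans ?_⟩
  rw [← load_univ]
  exact load_mono _ (Set.subset_univ _)

end LowerBound

/-! ### The two games during arbitrary schedules -/

section Games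

variable {V : Type*} {T : SimpleGraph V}

theorem exists_eq_of_slide_legal {c : V → ℕ} {m : SearchMove V} (hm : m.Legal T c) {e : Sym2 V}
    (he : e ∈ m.traversed) : ∃ a b, m = .slide a b ∧ e = s(a, b) ∧ T.Adj a b ∧ 0 < c a := by
  cases m with
  | place v => exact absurd he (Set.notMem_empty _)
  | slide a b => exact ⟨a, b, rfl, he, hm⟩
  | remove v => exact absurd he (Set.notMem_empty _)

theorem eUnguardedConn_self (c : V → ℕ) {e : Sym2 V} (he : e ∈ T.edgeSet) :
    EUnguardedConn T c e e := by
  induction e with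
  | _ a b =>
    refine ⟨a, b, (SimpleGraph.mem_edgeSet T).1 he |>.toWalk, ?_, ?_, ?_, ?_, ?_⟩
    · have := ((SimpleGraph.mem_edgeSet T).1 he).ne
      simpa [SimpleGraph.Adj.toWalk] using this
    all_goals simp [SimpleGraph.Adj.toWalk]
    intro i _ _
    omega

variable [DecidableEq V] {S : List (SearchMove V)}

theorem occ_succ {t : ℕ} (ht : t < S.length) : occ S (t + 1) = (S[t]).apply (occ S t) := by
  rw [occ, List.take_add_one, List.getElem?_eq_getElem ht, Option.toList_some, List.foldl_concat]
  rfl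

theorem occ_zero (S : List (SearchMove V)) (v : V) : occ S 0 v = 0 := by simp [occ]

theorem nUnguardedConn_of_walk {c : V → ℕ} {u v : V} (p : T.Walk u v)
    (h : ∀ w ∈ p.support, c w = 0) : NUnguardedConn T c u v :=
  ⟨p.bypass, p.bypass_isPath, fun w hw => h w (p.support_bypass_subset_support hw)⟩

theorem occ_eq_zero_of_mem_nDirty {t : ℕ} {u : V} (h : u ∈ nDirty T S t) : occ S t u = 0 := by
  cases t with
  | zero => exact occ_zero S u
  | succ t =>
    obtain ⟨v, -, p, -, hp⟩ := h
    exact hp u p.start_mem_support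

theorem occ_pos_of_adj_nDirty {t : ℕ} {v w : V} (hvw : T.Adj v w) (hv : v ∈ nClear T S t)
    (hw : w ∈ nDirty T S t) : 0 < occ S t v := by
  cases t with
  | zero => exact absurd (Set.mem_univ v) hv
  | succ t =>
    by_contra! h0
    obtain ⟨x, hx, p, -, hp⟩ := hw
    refine hv ⟨x, hx, nUnguardedConn_of_walk (.cons hvw p) ?_⟩
    simp only [SimpleGraph.Walk.support_cons, List.mem_cons, forall_eq_or_imp]
    exact ⟨by omega, hp⟩

theorem mem_nDirty_succ {t : ℕ} {v : V} (hv : v ∈ nDirty T S t) (h0 : occ S (t + 1) v = 0) :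
    v ∈ nDirty T S (t + 1) :=
  ⟨v, hv, nUnguardedConn_of_walk .nil (by simpa using h0)⟩

theorem IsIMCNodeClearing.exists_isSweep [Nonempty V] (h : IsIMCNodeClearing T S) :
    ∃ r, IsSweep T r (S.length - 1) (fun i => occ S (i + 1)) (fun i => nClear T S (i + 1)) := by
  obtain ⟨hS, -, hm, hc, hfin⟩ := h
  have hlen : 0 < S.length := by
    by_contra! h0
    rw [Nat.le_zero.1 h0] at hfin
    exact Set.univ_nonempty.ne_empty hfin
  have hn : S.length - 1 + 1 = S.length := by omega
  have h0 := hS 0 hlen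
  obtain ⟨r, hr⟩ : ∃ r, S[0] = .place r := by
    cases h1 : S[0] with
    | place r => exact ⟨r, rfl⟩
    | slide u v => simp [h1, SearchMove.Legal, occ_zero] at h0
    | remove u => simp [h1, SearchMove.Legal, occ_zero] at h0
  have hocc : ∀ v, occ S 1 v = if v = r then 1 else 0 := fun v => by
    rw [occ_succ hlen, hr]
    simp [SearchMove.apply, occ_zero]
  refine ⟨r, ?_, ?_, fun i hi => hm _ (by omega), fun i hi => (hc _ (by omega) (by omega)).1,
    fun i _ v hv hd => hv.ne' (occ_eq_zero_of_mem_nDirty hd),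
    fun i _ v w hvw hv hw => occ_pos_of_adj_nDirty hvw hv (not_not.1 hw), ?_⟩
  · ext v
    simp only [nClear, Set.mem_compl_iff, Set.mem_singleton_iff]
    refine not_iff_comm.1 ⟨fun hv => ?_, fun hd hv => ?_⟩
    · exact mem_nDirty_succ (Set.mem_univ v) (by simp [hocc, hv])
    · have := occ_eq_zero_of_mem_nDirty hd
      simp [hocc, hv] at this
  · simp [nClear, hn, hfin]
  · intro i _ v hv hv'
    by_contra! h0
    exact hv' (mem_nDirty_succ (not_not.1 hv) (by omega))

theorem eDirty_subset (t : ℕ) : eDirty T S t ⊆ T.edgeSet := by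
  cases t with
  | zero => exact subset_rfl
  | succ t =>
    rintro e ⟨f, -, -, a, b, p, hp, hl, rfl, -⟩
    exact p.adj_snd (by rw [SimpleGraph.Walk.not_nil_iff_lt_length]; exact hl)

theorem mem_eDirty_succ {t : ℕ} {e : Sym2 V} (he : e ∈ eDirty T S t)
    (h : ∀ m ∈ S[t]?, e ∉ m.traversed) : e ∈ eDirty T S (t + 1) :=
  ⟨e, he, h, eUnguardedConn_self _ (eDirty_subset t he)⟩

/-- Contamination spreads through an unguarded node: the connection of edges can be prolonged at
its first end. -/
theorem EUnguardedConn.cons (hT : T.IsTree) {c : V → ℕ} {a b w : V} {f : Sym2 V}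
    (h : EUnguardedConn T c s(a, w) f) (ha : c a = 0) (hab : T.Adj a b) :
    EUnguardedConn T c s(b, a) f := by
  -- a path that starts at `a` and does not run through `b` can be prolonged by `b`
  have key : ∀ (z : V) (p : T.Walk a z), p.IsPath → 0 < p.length → f = s(p.penultimate, z) →
      (∀ i, 0 < i → i < p.length → c (p.getVert i) = 0) → EUnguardedConn T c s(b, a) f := by
    intro z p hp hl hf hi
    by_cases hb : b ∈ p.support
    · have hsnd : p.snd = b := by
        have h1 : (SimpleGraph.Walk.cons hab .nil).IsPath := by simp [hab.ne]
        have h2 := congrArg SimpleGraph.Walk.snd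
          ((hT.existsUnique_path _ _).unique (hp.takeUntil hb) h1)
        simp only [SimpleGraph.Walk.snd_cons] at h2
        rwa [SimpleGraph.Walk.snd_takeUntil hab.ne'] at h2
      exact ⟨a, z, p, hp, hl, by rw [hsnd, Sym2.eq_swap], hf, hi⟩
    · refine ⟨b, z, .cons hab.symm p, hp.cons hb, by simp, by simp, ?_, ?_⟩
      · rwa [SimpleGraph.Walk.penultimate_cons_of_not_nil _ _
          (by rw [SimpleGraph.Walk.not_nil_iff_lt_length]; exact hl)]
      · intro i hi0 hil
        obtain ⟨i, rfl⟩ := Nat.exists_eq_succ_of_ne_zero hi0.ne'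
        rw [Nat.succ_eq_add_one, SimpleGraph.Walk.getVert_cons_succ]
        rcases Nat.eq_zero_or_pos i with rfl | hpos
        · simpa using ha
        · exact hi i hpos (by simpa using hil)
  obtain ⟨x, z, p, hp, hl, he, hf, hi⟩ := h
  rcases Sym2.eq_iff.1 he with ⟨rfl, -⟩ | ⟨hax, rfl⟩
  · exact key z p hp hl hf hi
  · cases p with
    | nil => simp at hl
    | @cons _ y _ hwy q =>
      obtain rfl : a = y := by simpa using hax
      cases q with
      | nil =>
        -- the connection consists of the edge from `w` to `a` only
        by_cases hbw : b = w
        · subst hbw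
          exact ⟨b, a, .cons hwy .nil, hp, hl, by simp, hf, hi⟩
        · refine ⟨b, w, .cons hab.symm (.cons hwy.symm .nil), ?_, by simp, by simp, ?_, ?_⟩
          · simp [hab.ne', hbw, hwy.ne']
          · rw [hf, Sym2.eq_swap]
            rfl
          · intro i hi0 hil
            obtain rfl : i = 1 := by simp at hil; omega
            simpa using ha
      | @cons _ y' _ hay q =>
        refine key z (.cons hay q) hp.of_cons (by simp) hf fun i hi0 hil => ?_
        have := hi (i + 1) (by omega) (by simpa using hil)
        rwa [SimpleGraph.Walk.getVert_cons_succ] at this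

theorem adj_mem_eDirty (hT : T.IsTree) {t : ℕ} {a b w : V} (h : s(a, w) ∈ eDirty T S t)
    (ha : occ S t a = 0) (hab : T.Adj a b) : s(a, b) ∈ eDirty T S t := by
  cases t with
  | zero => exact hab
  | succ t =>
    obtain ⟨f, hf, hm, hc⟩ := h
    rw [Sym2.eq_swap]
    exact ⟨f, hf, hm, hc.cons hT ha hab⟩

theorem mem_eClearNodes_of_eClear (hT : T.IsTree) {t : ℕ} {a b : V} (h : s(a, b) ∈ eClear T S t) :
    a ∈ eClearNodes T S t :=
  fun ⟨h0, _, hw⟩ => h.2 (adj_mem_eDirty hT hw h0 h.1)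

/-- A node that is not guarded immediately after a move does not become clear by this move. -/
theorem occ_pos_of_fresh (hS : IsSchedule T S) {t : ℕ} (ht : t < S.length) {v : V}
    (hv : v ∉ eClearNodes T S t) (hv' : v ∈ eClearNodes T S (t + 1)) : 0 < occ S (t + 1) v := by
  by_contra! h0
  obtain ⟨hv0, w, hw⟩ := not_not.1 hv
  have hw' : s(v, w) ∉ eDirty T S (t + 1) := fun hd => hv' ⟨by omega, w, hd⟩
  have htr : s(v, w) ∈ (S[t]).traversed := by
    by_contra hn
    refine hw' (mem_eDirty_succ hw fun m hm => ?_)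
    rw [List.getElem?_eq_getElem ht, Option.mem_some_iff] at hm
    rwa [← hm]
  obtain ⟨a, b, hm, he, hab, ha⟩ := exists_eq_of_slide_legal (hS t ht) htr
  rcases Sym2.eq_iff.1 he with ⟨rfl, -⟩ | ⟨rfl, -⟩
  · omega
  · rw [occ_succ ht, hm] at h0
    simp [SearchMove.apply, hab.ne'] at h0

/-- Before an edge becomes clear, connectedness keeps all searchers on one node but monotonicity does
not prevent them from wandering around, so the sweep starts at some time `t₀`. -/
theorem IsIMCEdgeClearing.exists_isSweep [Nontrivial V] (hT : T.IsTree)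
    (h : IsIMCEdgeClearing T S) :
    ∃ r t₀, t₀ ≤ S.length ∧ IsSweep T r (S.length - t₀) (fun i => occ S (t₀ + i))
      (fun i => eClearNodes T S (t₀ + i)) := by
  obtain ⟨hS, -, hm, hc, hfin⟩ := h
  -- the search starts in earnest with the first move that clears an edge
  have hex : ∃ t, t ≤ S.length ∧ (eClear T S t).Nonempty := by
    obtain ⟨x⟩ := (inferInstance : Nonempty V)
    obtain ⟨y, hxy⟩ := hT.connected.preconnected.exists_adj_of_nontrivial x
    exact ⟨S.length, le_rfl, s(x, y), hxy, by simp [hfin]⟩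
  classical
  obtain ⟨hle, e, he⟩ := Nat.find_spec hex
  have hempty0 : eClear T S 0 = ∅ := by simp [eClear, eDirty]
  obtain ⟨t₀, ht₀⟩ := Nat.exists_eq_succ_of_ne_zero (n := Nat.find hex)
    fun h0 => by rw [h0, hempty0] at he; exact he
  have hempty : eClear T S t₀ = ∅ := by
    have := Nat.find_min hex (m := t₀) (by omega)
    by_contra hne
    exact this ⟨by omega, Set.nonempty_iff_ne_empty.2 hne⟩
  rw [ht₀, Nat.succ_eq_add_one] at hle he
  have ht : t₀ < S.length := hle
  have hed : e ∈ eDirty T S t₀ := by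
    by_contra hn
    have : e ∈ eClear T S t₀ := ⟨he.1, hn⟩
    rw [hempty] at this
    exact this
  have htr : e ∈ (S[t₀]).traversed := by
    by_contra hn
    refine he.2 (mem_eDirty_succ hed fun m hm => ?_)
    rw [List.getElem?_eq_getElem ht, Option.mem_some_iff] at hm
    rwa [← hm]
  obtain ⟨r, v, hmv, rfl, hrv, hr⟩ := exists_eq_of_slide_legal (hS t₀ ht) htr
  have ht₀pos : 1 ≤ t₀ := by
    by_contra! h0
    obtain rfl : t₀ = 0 := by omega
    simp [occ_zero] at hr
  have hrmem : r ∈ eClearNodes T S t₀ := fun h => hr.ne' h.1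
  -- without clear edges, a connected clear graph has a single node
  have hstart : eClearNodes T S t₀ = {r} := by
    refine Set.eq_singleton_iff_unique_mem.2 ⟨hrmem, fun w hw => ?_⟩
    by_contra hne
    have hcon := (hc t₀ ht₀pos ht.le).preconnected
    have : Nontrivial (eClearNodes T S t₀) :=
      ⟨⟨w, hw⟩, ⟨r, hrmem⟩, fun h => hne (congrArg Subtype.val h)⟩
    obtain ⟨u, hu⟩ := hcon.exists_adj_of_nontrivial ⟨w, hw⟩
    have hu' : s(w, (u : V)) ∈ eClear T S t₀ := hu
    rw [hempty] at hu'
    exact hu'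
  have hmono : ∀ i, t₀ + 1 + i ≤ S.length → s(r, v) ∈ eClear T S (t₀ + 1 + i) := by
    intro i
    induction i with
    | zero => exact fun _ => he
    | succ i ih => exact fun hi => hm (t₀ + 1 + i) (by omega) (ih (by omega))
  refine ⟨r, t₀, ht.le, hstart, ?_, ?_, ?_, ?_, ?_, ?_⟩
  · rw [Nat.add_sub_cancel' ht.le]
    simp [eClearNodes, hfin]
  · intro i hi
    rcases Nat.eq_zero_or_pos i with rfl | hpos
    · rw [add_zero, hstart, Set.singleton_subset_iff]
      exact mem_eClearNodes_of_eClear hT he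
    · -- from now on each clear node is incident to a clear edge, which stays clear
      obtain ⟨i, rfl⟩ := Nat.exists_eq_succ_of_ne_zero hpos.ne'
      have hidx : t₀ + i.succ = t₀ + 1 + i := by omega
      have hidx' : t₀ + (i.succ + 1) = t₀ + 1 + i + 1 := by omega
      rw [hidx, hidx']
      have hcl := hmono i (by omega)
      have hr1 := mem_eClearNodes_of_eClear hT hcl
      have hv1 := mem_eClearNodes_of_eClear hT (a := v) (b := r) (by rwa [Sym2.eq_swap])
      intro w hw
      have : Nontrivial (eClearNodes T S (t₀ + 1 + i)) :=
        ⟨⟨r, hr1⟩, ⟨v, hv1⟩, fun h => hrv.ne (congrArg Subtype.val h)⟩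
      obtain ⟨u, hu⟩ := (hc (t₀ + 1 + i) (by omega)
        (by omega)).preconnected.exists_adj_of_nontrivial ⟨w, hw⟩
      exact mem_eClearNodes_of_eClear hT (hm (t₀ + 1 + i) (by omega) hu)
  · intro i hi
    have hi' : t₀ + i ≤ S.length := by omega
    refine (hc (t₀ + i) (ht₀pos.trans (Nat.le_add_right _ _)) hi').preconnected.mono ?_
    intro a b hab
    exact (hab : s((a : V), (b : V)) ∈ eClear T S (t₀ + i)).1
  · exact fun i _ v hv h => hv.ne' h.1
  · intro i _ v w hvw hv hw
    by_contra! h0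
    refine hv ⟨by omega, w, ?_⟩
    by_contra hn
    refine hw (mem_eClearNodes_of_eClear hT (b := v) ?_)
    rw [Sym2.eq_swap]
    exact ⟨hvw, hn⟩
  · exact fun i hi v hv hv' => occ_pos_of_fresh hS (t := t₀ + i) (by omega) hv hv'

theorem sn_le_maxSn [Fintype V] {t : ℕ} (ht : t ≤ S.length) : sn S t ≤ maxSn S :=
  Finset.le_sup (f := sn S) (Finset.mem_range.2 (Nat.lt_succ_of_le ht))

variable [Fintype V] [Nontrivial V] [DecidableRel T.Adj]

theorem IsIMCNodeClearing.exists_mu_le_maxSn (hT : T.IsTree) (h : IsIMCNodeClearing T S) :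
    ∃ r, mu hT r ≤ maxSn S := by
  obtain ⟨r, hr⟩ := h.exists_isSweep
  obtain ⟨i, hi, hle⟩ := hr.exists_mu_le hT
  rcases Nat.eq_zero_or_pos S.length with h0 | hpos
  · have := h.2.2.2.2
    rw [h0] at this
    exact absurd this Set.univ_nonempty.ne_empty
  · exact ⟨r, hle.trans (sn_le_maxSn (by omega))⟩

theorem IsIMCEdgeClearing.exists_mu_le_maxSn (hT : T.IsTree) (h : IsIMCEdgeClearing T S) :
    ∃ r, mu hT r ≤ maxSn S := by
  obtain ⟨r, t₀, ht₀, hr⟩ := h.exists_isSweep hT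
  obtain ⟨i, hi, hle⟩ := hr.exists_mu_le hT
  exact ⟨r, hle.trans (sn_le_maxSn (by omega))⟩

end Games

/-! ### Schedules that never lose a visited node -/

section Visits

variable {V : Type*} {T : SimpleGraph V}

/-- The set consisting of the node that is occupied by a move, if there is one. -/
def SearchMove.target : SearchMove V → Set V
  | .place v => {v}
  | .slide _ v => {v}
  | .remove _ => ∅

/-- The nodes that are occupied at some time by the moves of a list. -/
def visited (l : List (SearchMove V)) : Set V := {v | ∃ m ∈ l, v ∈ m.target}

@[simp] theorem visited_nil : visited ([] : List (SearchMove V)) = ∅ := by simp [visited]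

@[simp] theorem visited_cons (m : SearchMove V) (l : List (SearchMove V)) :
    visited (m :: l) = m.target ∪ visited l := by
  ext
  simp [visited]

theorem visited_concat (l : List (SearchMove V)) (m : SearchMove V) :
    visited (l ++ [m]) = visited l ∪ m.target := by
  ext
  simp only [visited, List.mem_append, List.mem_singleton, Set.mem_ofPred_eq, Set.mem_union]
  grind

theorem visited_take_succ {S : List (SearchMove V)} {t : ℕ} (ht : t < S.length) :
    visited (S.take (t + 1)) = visited (S.take t) ∪ S[t].target := by
  rw [List.take_add_one, List.getElem?_eq_getElem ht, Option.toList_some, visited_concat]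

theorem visited_take_mono {S : List (SearchMove V)} {t : ℕ} (ht : t < S.length) :
    visited (S.take t) ⊆ visited (S.take (t + 1)) := by
  rw [visited_take_succ ht]
  exact Set.subset_union_left

/-- All nodes of `A` with a neighbor outside of `A` are guarded. -/
def FrontierGuarded (T : SimpleGraph V) (c : V → ℕ) (A : Set V) : Prop :=
  ∀ v w, T.Adj v w → v ∈ A → w ∉ A → 0 < c v

/-- Recontamination cannot pass a guarded frontier: if the last edge of a path with unguarded
interior nodes leaves `A`, so does the first one. -/
theorem FrontierGuarded.exists_notMem_first {c : V → ℕ} {A : Set V} (h : FrontierGuarded T c A)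
    {a b : V} (p : T.Walk a b) (hl : 0 < p.length)
    (hi : ∀ i, 0 < i → i < p.length → c (p.getVert i) = 0)
    (hlast : ∃ v ∈ s(p.penultimate, b), v ∉ A) : ∃ v ∈ s(a, p.snd), v ∉ A := by
  induction p with
  | nil => simp at hl
  | @cons a v b hav q ih =>
    cases q with
    | nil => simpa using hlast
    | @cons _ w _ hvw q =>
      have hv0 : c v = 0 := hi 1 one_pos (by simp)
      have := ih (by simp) (fun i hi0 hil => by
        have := hi (i + 1) (by omega) (by simpa using hil)
        rwa [SimpleGraph.Walk.getVert_cons_succ] at this) hlast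
      refine ⟨v, by simp, fun hvA => ?_⟩
      simp only [SimpleGraph.Walk.snd_cons, Sym2.mem_iff, exists_eq_or_imp, exists_eq_left] at this
      rcases this with hv | hw
      · exact hv hvA
      · exact (h v w hvw hvA hw).ne' hv0

/-- Otherwise the two edges at `v` would close a cycle. -/
theorem eq_of_adj_of_walk (hT : T.IsTree) {a w v : V} (p : T.Walk a w) (hv : v ∉ p.support)
    (ha : T.Adj a v) (hw : T.Adj w v) : a = w := by
  classical
  have h1 : (p.bypass.concat hw).IsPath :=
    p.bypass_isPath.concat (fun h => hv (p.support_bypass_subset_support h)) hw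
  have h2 : (SimpleGraph.Walk.cons ha .nil).IsPath := by simp [ha.ne]
  have h3 := congrArg SimpleGraph.Walk.penultimate ((hT.existsUnique_path _ _).unique h1 h2)
  simpa using h3.symm

variable [DecidableEq V] {S : List (SearchMove V)} {r : V}

/-- A schedule that places searchers only on `r`, never removes them, keeps at all times the
visited nodes with unvisited neighbors guarded, and visits all nodes. In both games the clear
part of the graph is then the visited part. -/
structure IsExploration (T : SimpleGraph V) (r : V) (S : List (SearchMove V)) : Prop where
  schedule : IsSchedule T S
  internal : IsInternal S
  rooted : IsRooted r S
  frontier : ∀ t ≤ S.length, FrontierGuarded T (occ S t) (visited (S.take t))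
  visited_eq : visited S = Set.univ

theorem SearchMove.pos_or_mem_target {m : SearchMove V} {c : V → ℕ} {v : V}
    (h : 0 < m.apply c v) : 0 < c v ∨ v ∈ m.target := by
  cases m with
  | place u =>
    by_cases hv : v = u
    · exact .inr hv
    · exact .inl (by simpa [SearchMove.apply, hv] using h)
  | slide u w =>
    by_cases hv : v = w
    · exact .inr hv
    · simp only [SearchMove.apply, hv, if_false] at h
      left
      split_ifs at h <;> omega
  | remove u =>
    simp only [SearchMove.apply] at h
    left
    split_ifs at h <;> omega

theorem mem_visited_of_occ_pos {t : ℕ} {v : V} (h : 0 < occ S t v) : v ∈ visited (S.take t) := by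
  unfold occ at h
  generalize S.take t = l at *
  induction l using List.reverseRecOn with
  | nil => simp at h
  | append_singleton l m ih =>
    rw [visited_concat]
    rw [List.foldl_concat] at h
    exact (SearchMove.pos_or_mem_target h).imp ih id

theorem IsExploration.eq_place_or_slide (h : IsExploration T r S) {t : ℕ} (ht : t < S.length) :
    S[t] = .place r ∨ ∃ a b, S[t] = .slide a b ∧ T.Adj a b ∧ a ∈ visited (S.take t) := by
  have hl := h.schedule t ht
  have hm := List.getElem_mem ht
  cases hc : S[t] with
  | place v =>
    rw [hc] at hm
    exact .inl (by rw [h.rooted v hm])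
  | slide a b =>
    rw [hc] at hl
    exact .inr ⟨a, b, rfl, hl.1, mem_visited_of_occ_pos hl.2⟩
  | remove u =>
    rw [hc] at hm
    exact absurd hm (h.internal u)

theorem IsExploration.exists_walk (h : IsExploration T r S) {t : ℕ} (ht : t ≤ S.length) {v : V}
    (hv : v ∈ visited (S.take t)) : ∃ p : T.Walk r v, ∀ w ∈ p.support, w ∈ visited (S.take t) := by
  induction t generalizing v with
  | zero => simp at hv
  | succ t ih =>
    rw [visited_take_succ ht] at hv ⊢
    rcases hv with hv | hv
    · obtain ⟨p, hp⟩ := ih (by omega) hv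
      exact ⟨p, fun w hw => .inl (hp w hw)⟩
    · rcases h.eq_place_or_slide ht with hm | ⟨a, b, hm, hab, ha⟩
      · rw [hm] at hv ⊢
        obtain rfl : v = r := hv
        exact ⟨.nil, fun w hw => .inr (by simpa [SearchMove.target] using hw)⟩
      · rw [hm] at hv ⊢
        obtain rfl : v = b := hv
        obtain ⟨p, hp⟩ := ih (by omega) ha
        refine ⟨p.concat hab, fun w hw => ?_⟩
        rw [SimpleGraph.Walk.support_concat, List.mem_append, List.mem_singleton] at hw
        exact hw.imp (hp w) id

theorem IsExploration.connected (h : IsExploration T r S) {t : ℕ} (h1 : 1 ≤ t)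
    (ht : t ≤ S.length) : (T.induce (visited (S.take t))).Connected := by
  have hr : r ∈ visited (S.take t) := by
    rcases h.eq_place_or_slide (t := 0) (by omega) with hm | ⟨a, b, -, -, ha⟩
    · refine ⟨S[0], ?_, by rw [hm]; rfl⟩
      rw [List.mem_take_iff_getElem]
      exact ⟨0, by omega, rfl⟩
    · simp at ha
  rw [SimpleGraph.connected_iff_exists_forall_reachable]
  refine ⟨⟨r, hr⟩, fun ⟨v, hv⟩ => ?_⟩
  obtain ⟨p, hp⟩ := h.exists_walk ht hv
  exact ⟨p.induce _ hp⟩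

/-- In the node game the visited nodes of an exploration are the clear ones. -/
theorem IsExploration.nClear_eq (h : IsExploration T r S) {t : ℕ} (ht : t ≤ S.length) :
    nClear T S t = visited (S.take t) := by
  rw [nClear, compl_eq_comm]
  induction t with
  | zero => simp [nDirty]
  | succ t ih =>
    ext v
    constructor
    · intro hv
      refine mem_nDirty_succ ?_ ?_
      · rw [← ih (by omega)]
        exact fun hv' => hv (by rw [visited_take_succ ht]; exact .inl hv')
      · by_contra h0
        exact hv (mem_visited_of_occ_pos (Nat.pos_of_ne_zero h0))
    · rintro ⟨w, hw, p, -, hp⟩ hv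
      rw [← ih (by omega)] at hw
      have hw' : w ∉ visited (S.take (t + 1)) := by
        rw [visited_take_succ ht]
        rintro (h' | h')
        · exact hw h'
        · have h0 := hp w p.end_mem_support
          -- a node that is occupied by a move is guarded after this move
          rw [occ_succ (by omega)] at h0
          rcases h.eq_place_or_slide ht with hm | ⟨a, b, hm, hab, -⟩
          · rw [hm] at h0 h'
            obtain rfl : w = r := h'
            simp [SearchMove.apply] at h0
          · rw [hm] at h0 h'
            obtain rfl : w = b := h'
            simp [SearchMove.apply, hab.ne'] at h0
      obtain ⟨d, hd, h1, h2⟩ := p.exists_boundary_dart _ hv hw'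
      exact (h.frontier (t + 1) ht _ _ d.adj h1 h2).ne'
        (hp _ (p.dart_fst_mem_support_of_mem_darts hd))

theorem IsExploration.isIMCNodeClearing (h : IsExploration T r S) : IsIMCNodeClearing T S := by
  refine ⟨h.schedule, h.internal, fun t ht => ?_, fun t h1 ht => ?_, ?_⟩
  · rw [h.nClear_eq ht.le, h.nClear_eq ht]
    exact visited_take_mono ht
  · rw [nClearGraph, h.nClear_eq ht]
    exact h.connected h1 ht
  · have := h.nClear_eq le_rfl
    rw [List.take_length, h.visited_eq, nClear] at this
    exact Set.compl_univ_iff.1 this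

/-- In the edge game an edge is clear in an exploration as soon as both of its ends are visited: the
second end can be entered only through this edge. -/
theorem IsExploration.eDirty_eq (h : IsExploration T r S) (hT : T.IsTree) {t : ℕ}
    (ht : t ≤ S.length) :
    eDirty T S t = {e ∈ T.edgeSet | ∃ v ∈ e, v ∉ visited (S.take t)} := by
  induction t with
  | zero =>
    ext e
    induction e with
    | _ a b => simp [eDirty]
  | succ t ih =>
    have ih := ih (by omega)
    have hsub := visited_take_mono (S := S) ht
    ext e
    constructor
    · intro he
      refine ⟨eDirty_subset _ he, ?_⟩
      obtain ⟨f, hf, hm, a, b, p, -, hl, rfl, rfl, hi⟩ := he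
      refine (h.frontier (t + 1) ht).exists_notMem_first p hl hi ?_
      rw [ih] at hf
      obtain ⟨hfe, v, hvf, hv⟩ := hf
      generalize s(p.penultimate, b) = f at *
      obtain ⟨w, rfl⟩ := hvf
      have hvw : T.Adj v w := hfe
      by_contra! hall
      have hv1 := hall v (by simp)
      have hw1 := hall w (by simp)
      rw [visited_take_succ ht] at hv1 hw1
      replace hv1 := hv1.resolve_left hv
      rcases h.eq_place_or_slide ht with htg | ⟨a', b', htg, hab, ha⟩
      · rw [htg] at hv1 hw1
        obtain rfl : v = r := hv1
        replace hw1 := hw1.resolve_right fun hw => hvw.ne' hw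
        obtain ⟨q, hq⟩ := h.exists_walk (by omega) hw1
        exact hv (hq _ q.start_mem_support)
      · rw [htg] at hv1 hw1
        obtain rfl : v = b' := hv1
        replace hw1 := hw1.resolve_right fun hw => hvw.ne' hw
        obtain ⟨q₁, hq₁⟩ := h.exists_walk (by omega) ha
        obtain ⟨q₂, hq₂⟩ := h.exists_walk (by omega) hw1
        -- since the visited part is connected, it is entered through the edge of the slide only
        obtain rfl : a' = w := by
          refine eq_of_adj_of_walk hT (q₁.reverse.append q₂) (fun hs => hv ?_) hab hvw.symm
          rw [SimpleGraph.Walk.mem_support_append_iff, SimpleGraph.Walk.support_reverse,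
            List.mem_reverse] at hs
          exact hs.elim (hq₁ v) (hq₂ v)
        refine hm _ (List.getElem?_eq_getElem ht) ?_
        rw [htg]
        exact Sym2.eq_swap
    · rintro ⟨hee, v, hve, hv⟩
      refine mem_eDirty_succ (by rw [ih]; exact ⟨hee, v, hve, fun h' => hv (hsub h')⟩) ?_
      intro m hm htr
      rw [List.getElem?_eq_getElem ht, Option.mem_some_iff] at hm
      subst hm
      rcases h.eq_place_or_slide ht with htg | ⟨a, b, htg, hab, ha⟩
      · rw [htg] at htr
        exact htr
      · rw [htg] at htr
        obtain rfl : e = s(a, b) := htr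
        rcases Sym2.mem_iff.1 hve with rfl | rfl
        · exact hv (hsub ha)
        · exact hv (by rw [visited_take_succ ht, htg]; exact .inr rfl)

theorem IsExploration.mem_eClear_iff (h : IsExploration T r S) (hT : T.IsTree) {t : ℕ}
    (ht : t ≤ S.length) {a b : V} : s(a, b) ∈ eClear T S t ↔
      T.Adj a b ∧ a ∈ visited (S.take t) ∧ b ∈ visited (S.take t) := by
  simp only [eClear, h.eDirty_eq hT ht, Set.mem_sdiff, SimpleGraph.mem_edgeSet, Set.mem_ofPred_eq,
    Sym2.mem_iff, exists_eq_or_imp, exists_eq_left]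
  tauto

theorem IsExploration.eClearNodes_eq [Nontrivial V] (h : IsExploration T r S) (hT : T.IsTree)
    {t : ℕ} (ht : t ≤ S.length) : eClearNodes T S t = visited (S.take t) := by
  ext v
  simp only [eClearNodes, Set.mem_ofPred_eq, not_and, not_exists]
  constructor
  · intro hv
    by_cases h0 : occ S t v = 0
    · obtain ⟨w, hw⟩ := hT.connected.preconnected.exists_adj_of_nontrivial v
      exact ((h.mem_eClear_iff hT ht (b := w)).1 ⟨hw, hv h0 w⟩).2.1
    · exact mem_visited_of_occ_pos (Nat.pos_of_ne_zero h0)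
  · intro hv h0 w hw
    have hvw : T.Adj v w := eDirty_subset t hw
    refine ((h.mem_eClear_iff hT ht).2 ⟨hvw, hv, ?_⟩).2 hw
    by_contra hw'
    exact (h.frontier t ht v w hvw hv hw').ne' h0

theorem IsExploration.isIMCEdgeClearing [Nontrivial V] (h : IsExploration T r S)
    (hT : T.IsTree) : IsIMCEdgeClearing T S := by
  refine ⟨h.schedule, h.internal, fun t ht e he => ?_, fun t h1 ht => ?_, ?_⟩
  · induction e with
    | _ a b =>
      rw [h.mem_eClear_iff hT ht.le] at he
      rw [h.mem_eClear_iff hT ht]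
      exact ⟨he.1, visited_take_mono ht he.2.1, visited_take_mono ht he.2.2⟩
  · have : eClearGraph T S t = T.induce (eClearNodes T S t) := by
      ext a b
      have ha := (h.eClearNodes_eq hT ht).le a.2
      have hb := (h.eClearNodes_eq hT ht).le b.2
      exact (h.mem_eClear_iff hT ht).trans ⟨fun h => h.1, fun hab => ⟨hab, ha, hb⟩⟩
    rw [this, h.eClearNodes_eq hT ht]
    exact h.connected h1 ht
  · rw [h.eDirty_eq hT le_rfl, List.take_length, h.visited_eq]
    simp

end Visits

/-! ### The schedules of the algorithm -/

section Leads

variable {V : Type*} [DecidableEq V]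

/-- The moves of a list can be performed one after the other in the configuration `c` with the set
`A` of visited nodes, they lead to the configuration `c'` with the set `A'` of visited nodes, and
after each of them the visited nodes with unvisited neighbors are guarded. -/
inductive Leads (T : SimpleGraph V) :
    List (SearchMove V) → (V → ℕ) → Set V → (V → ℕ) → Set V → Prop
  | nil (c : V → ℕ) (A : Set V) : Leads T [] c A c A
  | cons {m : SearchMove V} {l : List (SearchMove V)} {c c' : V → ℕ} {A A' : Set V} :
      m.Legal T c → FrontierGuarded T (m.apply c) (A ∪ m.target) →
      Leads T l (m.apply c) (A ∪ m.target) c' A' → Leads T (m :: l) c A c' A'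

variable {T : SimpleGraph V} {c c' c'' : V → ℕ} {A A' A'' : Set V} {l l' : List (SearchMove V)}

theorem Leads.append (h : Leads T l c A c' A') (h' : Leads T l' c' A' c'' A'') :
    Leads T (l ++ l') c A c'' A'' := by
  induction h with
  | nil => exact h'
  | cons h1 h2 _ ih => exact .cons h1 h2 (ih h')

theorem Leads.frontier (h : Leads T l c A c' A') (hA : FrontierGuarded T c A) :
    FrontierGuarded T c' A' := by
  induction h with
  | nil => exact hA
  | cons _ h2 _ ih => exact ih h2

theorem Leads.eq_union_visited (h : Leads T l c A c' A') : A' = A ∪ visited l := by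
  induction h with
  | nil => simp
  | cons _ _ _ ih => rw [ih, visited_cons, Set.union_assoc]

theorem Leads.eq_foldl (h : Leads T l c A c' A') : c' = l.foldl (fun c m => m.apply c) c := by
  induction h with
  | nil => rfl
  | cons _ _ _ ih => exact ih

theorem Leads.exists_of_append (h : Leads T (l ++ l') c A c' A') :
    ∃ c₁ A₁, Leads T l c A c₁ A₁ ∧ Leads T l' c₁ A₁ c' A' := by
  induction l generalizing c A with
  | nil => exact ⟨c, A, .nil c A, h⟩
  | cons m l ih =>
    cases h with
    | cons h1 h2 h3 =>
      obtain ⟨c₁, A₁, h4, h5⟩ := ih h3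
      exact ⟨c₁, A₁, .cons h1 h2 h4, h5⟩

theorem Leads.isExploration {S : List (SearchMove V)} {r : V}
    (h : Leads T S (fun _ => 0) ∅ c' Set.univ) (hr : IsRooted r S) (hi : IsInternal S) :
    IsExploration T r S := by
  refine ⟨fun t ht => ?_, hi, hr, fun t ht => ?_, ?_⟩
  · rw [← List.take_append_drop t S, List.drop_eq_getElem_cons ht] at h
    obtain ⟨c₁, A₁, h1, h2⟩ := h.exists_of_append
    cases h2 with
    | cons h3 _ _ =>
      rw [h1.eq_foldl] at h3
      exact h3
  · rw [← List.take_append_drop t S] at h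
    obtain ⟨c₁, A₁, h1, -⟩ := h.exists_of_append
    have hA : A₁ = visited (S.take t) := by simpa using h1.eq_union_visited
    have hc : c₁ = occ S t := h1.eq_foldl
    rw [← hA, ← hc]
    exact h1.frontier fun v _ _ hv => absurd hv (Set.notMem_empty v)
  · simpa using h.eq_union_visited.symm

theorem FrontierGuarded.place (hA : FrontierGuarded T c A) (r : V) :
    FrontierGuarded T ((SearchMove.place r).apply c) (A ∪ {r}) := by
  intro v w hvw hv hw
  by_cases hvr : v = r
  · simp [SearchMove.apply, hvr]
  · simp only [SearchMove.apply, hvr, if_false]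
    exact hA v w hvw (hv.resolve_right hvr) fun h => hw (.inl h)

theorem leads_replicate_place {r : V} (J : ℕ) (hA : FrontierGuarded T c A) :
    Leads T (List.replicate (J + 1) (.place r)) c A
      (fun w => if w = r then c w + (J + 1) else c w) (A ∪ {r}) := by
  induction J generalizing c A with
  | zero => exact .cons trivial (hA.place r) (.nil _ _)
  | succ J ih =>
    rw [List.replicate_succ]
    refine .cons trivial (hA.place r) ?_
    have := ih (hA.place r)
    rw [Set.union_assoc, Set.union_self] at this
    convert this using 1
    · rfl
    funext w
    simp only [SearchMove.apply]
    split_ifs <;> omega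

/-- The configuration after `J` searchers have moved from `x` to `y`. -/
def shift (c : V → ℕ) (x y : V) (J : ℕ) : V → ℕ :=
  fun w => if w = x then c w - J else if w = y then c w + J else c w

/-- It is safe to slide searchers from `x` to `y` if one of them stays at `x`, or else if all
neighbors of `x` other than `y` have been visited. -/
theorem leads_replicate_slide {x y : V} (hxy : T.Adj x y) {J : ℕ} (hJ : J + 1 ≤ c x) (hx : x ∈ A)
    (hA : FrontierGuarded T c A)
    (hn : ∀ w, T.Adj x w → w ∉ A → w ≠ y → J + 1 < c x) :
    Leads T (List.replicate (J + 1) (.slide x y)) c A (shift c x y (J + 1)) (A ∪ {y}) := by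
  have hf : FrontierGuarded T ((SearchMove.slide x y).apply c) (A ∪ {y}) := by
    intro v w hvw hv hw
    by_cases hvx : v = x
    · subst hvx
      have := hn w hvw (fun h => hw (.inl h)) fun h => hw (.inr h)
      simp only [SearchMove.apply, if_true]
      omega
    · by_cases hvy : v = y
      · simp [SearchMove.apply, hvy, hxy.ne']
      · simp only [SearchMove.apply, hvx, hvy, if_false]
        exact hA v w hvw (hv.resolve_right hvy) fun h => hw (.inl h)
  induction J generalizing c A with
  | zero => exact .cons ⟨hxy, by omega⟩ hf (.nil _ _)
  | succ J ih =>
    rw [List.replicate_succ]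
    refine .cons ⟨hxy, by omega⟩ hf ?_
    have hcx : (SearchMove.slide x y).apply c x = c x - 1 := by simp [SearchMove.apply]
    have hA' : (A ∪ {y}) ∪ {y} = A ∪ {y} := by simp
    have hlt : ∀ w, T.Adj x w → w ∉ A ∪ {y} → J + 1 + 1 < c x := fun w hw hwA =>
      hn w hw (fun h => hwA (.inl h)) fun h => hwA (.inr h)
    have := ih (c := (SearchMove.slide x y).apply c) (A := A ∪ {y}) (by omega) (.inl hx) hf
      (fun w hw hwA _ => by have := hlt w hw hwA; omega) (by
        rw [hA']
        intro v w hvw hv hw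
        by_cases hvx : v = x
        · subst hvx
          have := hlt w hvw hw
          simp only [SearchMove.apply, if_true]
          omega
        · have h0 := hf v w hvw hv hw
          simp only [SearchMove.apply, hvx, if_false] at h0 ⊢
          split_ifs at h0 ⊢
          all_goals omega)
    rw [hA'] at this
    convert this using 1
    · rfl
    funext w
    simp only [SearchMove.apply, shift]
    split_ifs <;> omega

variable [Fintype V] [DecidableRel T.Adj]

/-- The conditions under which the algorithm explores the branch of `d`: the branch is unvisited,
there are enough searchers at its entrance, and one of them can stay behind there unless this is
the last unvisited branch. -/
structure Ready (hT : T.IsTree) (d : T.Dart) (c : V → ℕ) (A : Set V) : Prop where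
  fst_mem : d.fst ∈ A
  disjoint : Disjoint A (branch d)
  label_le : label hT d ≤ c d.fst
  frontier : FrontierGuarded T c A
  label_lt : ∀ w, T.Adj d.fst w → w ∉ A → w ≠ d.snd → label hT d < c d.fst

/-- The branches at a node can be explored one after the other if at least one searcher more than
its label is available for each of them but the last. -/
theorem leads_flatMap (hT : T.IsTree) {y : V} {l : List T.Dart} {F : T.Dart → List (SearchMove V)}
    (hF : ∀ e ∈ l, ∀ c A, Ready hT e c A → Leads T (F e) c A c (A ∪ branch e))
    (hnd : l.Nodup) (hfst : ∀ e ∈ l, e.fst = y) (hy : y ∈ A)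
    (hdisj : ∀ e ∈ l, Disjoint A (branch e)) (hle : ∀ e ∈ l, label hT e ≤ c y)
    (hlt : l.Pairwise fun e _ => label hT e < c y) (hA : FrontierGuarded T c A)
    (hnb : ∀ w, T.Adj y w → w ∉ A → ∃ e ∈ l, e.snd = w) :
    Leads T (l.flatMap F) c A c (A ∪ {w | ∃ e ∈ l, w ∈ branch e}) := by
  induction l generalizing A with
  | nil =>
    have h0 : A ∪ {w | ∃ e ∈ ([] : List T.Dart), w ∈ branch e} = A := by simp
    rw [h0]
    exact .nil c A
  | cons e l ih =>
    rw [List.nodup_cons] at hnd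
    rw [List.pairwise_cons] at hlt
    have hey : e.fst = y := hfst e (by simp)
    have hready : Ready hT e c A := by
      refine ⟨by rwa [hey], hdisj e (by simp), by rw [hey]; exact hle e (by simp), hA, ?_⟩
      rw [hey]
      intro w hyw hw hne
      obtain ⟨e', he', rfl⟩ := hnb w hyw hw
      rcases List.mem_cons.1 he' with rfl | he'
      · exact absurd rfl hne
      · exact hlt.1 e' he'
    have h1 := hF e (by simp) c A hready
    have h2 := ih (A := A ∪ branch e) (fun e' he' => hF e' (by simp [he'])) hnd.2
      (fun e' he' => hfst e' (by simp [he'])) (.inl hy) (fun e' he' => by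
        rw [Set.disjoint_union_left]
        refine ⟨hdisj e' (by simp [he']), Set.disjoint_left.2 fun w hw hw' => hnd.1 ?_⟩
        rwa [dart_eq_of_mem_branch hT (hey.trans (hfst e' (by simp [he'])).symm) hw hw'])
      (fun e' he' => hle e' (by simp [he'])) hlt.2 (h1.frontier hA) (fun w hyw hw => by
        obtain ⟨e', he', rfl⟩ := hnb w hyw fun h => hw (.inl h)
        rcases List.mem_cons.1 he' with rfl | he'
        · exact absurd (.inr (snd_mem_branch _)) hw
        · exact ⟨e', he', rfl⟩)
    rw [List.flatMap_cons]
    convert h1.append h2 using 1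
    ext w
    simp [or_assoc]

theorem moveAlong_eq (hT : T.IsTree) (σ : Sorter hT) (d : T.Dart) (J : ℕ) :
    moveAlong hT σ d J = List.replicate J (.slide d.fst d.snd) ++
      ((σ.sort (nextDarts d)).reverse.flatMap fun e => moveAlong hT σ e (label hT e)) ++
      List.replicate J (.slide d.snd d.fst) := by
  rw [moveAlong]
  congr 2
  conv_rhs => rw [← List.attach_map_subtype_val (σ.sort (nextDarts d)).reverse, List.flatMap_map]

/-- All branches but the last one in the order of the algorithm have labels less than the
combination of the labels. -/
theorem Sorter.pairwise_label_lt {hT : T.IsTree} (σ : Sorter hT) (s : Finset T.Dart) :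
    (σ.sort s).reverse.Pairwise fun e _ => label hT e < combine (s.val.map (label hT)) := by
  rw [List.pairwise_reverse]
  refine ((σ.sorted s).and (σ.nodup s)).imp_of_mem fun {d e} hd he h => ?_
  exact succ_le_combine_map ((σ.mem_sort s e).1 he) ((σ.mem_sort s d).1 hd) h.2.symm h.1

/-- `Move` explores a branch and brings all searchers back to where they were. -/
theorem leads_moveAlong (hT : T.IsTree) (σ : Sorter hT) (d : T.Dart) {c : V → ℕ} {A : Set V}
    (h : Ready hT d c A) :
    Leads T (moveAlong hT σ d (label hT d)) c A c (A ∪ branch d) := by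
  induction hb : branchSize d using Nat.strong_induction_on generalizing d c A with
  | _ n ih =>
    subst hb
    obtain ⟨J, hJ⟩ := Nat.exists_eq_succ_of_ne_zero (label_pos hT d).ne'
    rw [Nat.succ_eq_add_one] at hJ
    have hle := h.label_le
    have hlt := h.label_lt
    have hxy := d.adj
    rw [moveAlong_eq, hJ]
    rw [hJ] at hle hlt
    have h1 := leads_replicate_slide hxy hle h.fst_mem h.frontier hlt
    have hc1 : J + 1 ≤ shift c d.fst d.snd (J + 1) d.snd := by
      simp [shift, hxy.ne']
    have hcomb := (label_eq hT d).symm.trans hJ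
    have h2 := leads_flatMap hT (y := d.snd) (l := (σ.sort (nextDarts d)).reverse)
      (F := fun e => moveAlong hT σ e (label hT e))
      (c := shift c d.fst d.snd (J + 1)) (A := A ∪ {d.snd})
      (fun e he c A hr => ih _ (branchSize_lt hT ((σ.mem_sort _ _).1 (List.mem_reverse.1 he)))
        e hr rfl)
      (List.nodup_reverse.2 (σ.nodup _))
      (fun e he => (mem_nextDarts.1 ((σ.mem_sort _ _).1 (List.mem_reverse.1 he))).1)
      (.inr rfl)
      (fun e he => by
        have he' := (σ.mem_sort _ _).1 (List.mem_reverse.1 he)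
        rw [Set.disjoint_union_left, Set.disjoint_singleton_left]
        refine ⟨h.disjoint.mono_right (branch_subset_of_mem_nextDarts hT he'), ?_⟩
        rw [← (mem_nextDarts.1 he').1]
        exact fst_notMem_branch e)
      (fun e he => by
        refine le_trans ?_ hc1
        rw [← hcomb]
        exact le_combine_of_mem
          (Multiset.mem_map_of_mem _ ((σ.mem_sort _ _).1 (List.mem_reverse.1 he))))
      ((σ.pairwise_label_lt _).imp fun hl => hl.trans_le (hcomb.le.trans hc1))
      (h1.frontier h.frontier)
      (fun w hw hwA => ⟨⟨(d.snd, w), hw⟩, by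
        simp only [List.mem_reverse, σ.mem_sort, mem_nextDarts, true_and]
        rintro rfl
        exact hwA (.inl h.fst_mem), rfl⟩)
    have hset : A ∪ {d.snd} ∪ {w | ∃ e ∈ (σ.sort (nextDarts d)).reverse, w ∈ branch e} =
        A ∪ branch d := by
      ext w
      simp [mem_branch_iff hT (d := d), σ.mem_sort, or_left_comm, or_assoc]
    rw [hset] at h2
    have h12 := h1.append h2
    have h3 := leads_replicate_slide hxy.symm hc1 (.inr (snd_mem_branch d))
      (h12.frontier h.frontier) fun w hw hwA hne =>
        absurd (eq_of_adj_of_mem_branch hT (snd_mem_branch d) (fun h => hwA (.inr h)) hw).2 hne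
    convert h12.append h3 using 1
    · funext w
      simp only [shift]
      split_ifs with hw1 hw2 hw2
      · exact absurd (hw1.symm.trans hw2) hxy.ne'
      · omega
      · subst hw2
        omega
      · rfl
    · rw [Set.union_assoc, Set.union_comm (branch d), ← Set.union_assoc,
        Set.union_eq_self_of_subset_right (Set.singleton_subset_iff.2 h.fst_mem)]

theorem exists_eq_slide_of_mem_moveAlong (hT : T.IsTree) (σ : Sorter hT) (d : T.Dart) {J : ℕ}
    {m : SearchMove V} (hm : m ∈ moveAlong hT σ d J) : ∃ a b, m = .slide a b := by
  induction hb : branchSize d using Nat.strong_induction_on generalizing d J with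
  | _ n ih =>
    subst hb
    rw [moveAlong_eq] at hm
    simp only [List.mem_append, List.mem_replicate, List.mem_flatMap, List.mem_reverse,
      σ.mem_sort] at hm
    rcases hm with (⟨-, rfl⟩ | ⟨e, he, hm⟩) | ⟨-, rfl⟩
    · exact ⟨_, _, rfl⟩
    · exact ih _ (branchSize_lt hT he) e hm rfl
    · exact ⟨_, _, rfl⟩

theorem mu_pos (hT : T.IsTree) (r : V) : 0 < mu hT r := by
  rcases (outDarts T r).eq_empty_or_nonempty with h | ⟨e, he⟩
  · simp [mu, h, combine_zero]
  · exact (label_pos hT e).trans_le (le_combine_of_mem (Multiset.mem_map_of_mem _ he))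

theorem eq_place_or_eq_slide_of_mem_searchFrom (hT : T.IsTree) (σ : Sorter hT) (r : V)
    {m : SearchMove V} (hm : m ∈ searchFrom hT σ r) : m = .place r ∨ ∃ a b, m = .slide a b := by
  simp only [searchFrom, List.mem_append, List.mem_replicate, List.mem_flatMap] at hm
  rcases hm with ⟨-, rfl⟩ | ⟨e, -, hm⟩
  · exact .inl rfl
  · exact .inr (exists_eq_slide_of_mem_moveAlong hT σ e hm)

theorem isExploration_searchFrom (hT : T.IsTree) (σ : Sorter hT) (r : V) :
    IsExploration T r (searchFrom hT σ r) := by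
  obtain ⟨J, hJ⟩ := Nat.exists_eq_succ_of_ne_zero (mu_pos hT r).ne'
  rw [Nat.succ_eq_add_one] at hJ
  have h0 : FrontierGuarded T (fun _ => 0) ∅ := fun v _ _ hv => absurd hv (Set.notMem_empty v)
  have h1 := leads_replicate_place (r := r) J h0
  have hmem : ∀ e, e ∈ (σ.sort (outDarts T r)).reverse ↔ e.fst = r := by
    simp [σ.mem_sort]
  have h2 := leads_flatMap hT (y := r) (l := (σ.sort (outDarts T r)).reverse)
    (F := fun e => moveAlong hT σ e (label hT e))
    (c := fun w => if w = r then 0 + (J + 1) else 0) (A := ∅ ∪ {r})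
    (fun e _ c A hr => leads_moveAlong hT σ e hr)
    (List.nodup_reverse.2 (σ.nodup _)) (fun e he => (hmem e).1 he) (.inr rfl)
    (fun e he => by
      rw [Set.empty_union, Set.disjoint_singleton_left, ← (hmem e).1 he]
      exact fst_notMem_branch e)
    (fun e he => by
      simp only [if_true, zero_add, ← hJ]
      exact le_combine_of_mem (Multiset.mem_map_of_mem _ (mem_outDarts.2 ((hmem e).1 he))))
    ((σ.pairwise_label_lt _).imp fun hl => by
      simp only [if_true, zero_add, ← hJ]
      exact hl)
    (h1.frontier h0) fun w hw _ => ⟨⟨(r, w), hw⟩, (hmem _).2 rfl, rfl⟩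
  have hset : (∅ ∪ {r}) ∪ {w | ∃ e ∈ (σ.sort (outDarts T r)).reverse, w ∈ branch e} =
      Set.univ := by
    refine Set.eq_univ_of_forall fun w => ?_
    by_cases hw : w = r
    · exact .inl (.inr hw)
    · obtain ⟨e, he, hwe⟩ := exists_outDarts_mem_branch hT hw
      exact .inr ⟨e, (hmem e).2 (mem_outDarts.1 he), hwe⟩
  rw [hset] at h2
  have h12 := h1.append h2
  rw [← hJ] at h12
  refine h12.isExploration (fun v hv => ?_) fun u hu => ?_
  · rcases eq_place_or_eq_slide_of_mem_searchFrom hT σ r hv with h | ⟨a, b, h⟩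
    · exact SearchMove.place.inj h
    · exact absurd h (by simp)
  · rcases eq_place_or_eq_slide_of_mem_searchFrom hT σ r hu with h | ⟨a, b, h⟩ <;> simp at h

theorem exists_sorter (hT : T.IsTree) : Nonempty (Sorter hT) := by
  refine ⟨⟨fun s => s.toList.mergeSort fun d e => decide (label hT e ≤ label hT d),
    fun s => ?_, fun s d => by simp, fun s => ?_⟩⟩
  · exact (List.mergeSort_perm _ _).nodup_iff.2 s.nodup_toList
  · have := List.pairwise_mergeSort (le := fun d e => decide (label hT e ≤ label hT d))
      (fun a b c hab hbc => by simp only [decide_eq_true_eq] at *; omega)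
      (fun a b => by simp only [Bool.or_eq_true, decide_eq_true_eq]; omega) s.toList
    simpa using this

/-! ### Minimality -/

theorem sum_apply_slide {a b : V} (hab : a ≠ b) (ha : 0 < c a) :
    ∑ v, (SearchMove.slide a b).apply c v = ∑ v, c v := by
  have h : ∑ v, ((SearchMove.slide a b).apply c v + if v = a then 1 else 0) =
      ∑ v, (c v + if v = b then 1 else 0) := by
    refine Finset.sum_congr rfl fun v _ => ?_
    by_cases hva : v = a
    · subst hva
      simp only [SearchMove.apply, if_true, hab, if_false]
      omega
    · simp only [SearchMove.apply, hva, if_false]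
      split_ifs <;> omega
  rw [Finset.sum_add_distrib, Finset.sum_add_distrib, Finset.sum_ite_eq', Finset.sum_ite_eq'] at h
  simpa using h

theorem sum_apply_place (r : V) : ∑ v, (SearchMove.place r).apply c v = ∑ v, c v + 1 := by
  have h : ∀ v, (SearchMove.place r).apply c v = c v + if v = r then 1 else 0 := fun v => by
    simp only [SearchMove.apply]
    split_ifs <;> rfl
  simp [h, Finset.sum_add_distrib]

/-- Only the initial placements bring searchers into the graph. -/
theorem maxSn_searchFrom_le (hT : T.IsTree) (σ : Sorter hT) (r : V) :
    maxSn (searchFrom hT σ r) ≤ mu hT r := by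
  have h := isExploration_searchFrom hT σ r
  set S := searchFrom hT σ r with hS
  have key : ∀ t ≤ S.length, sn S t ≤ min t (mu hT r) := by
    intro t
    induction t with
    | zero => intro _; simp [sn, occ_zero]
    | succ t ih =>
      intro ht
      have ih := ih (by omega)
      have hl := h.schedule t ht
      rcases h.eq_place_or_slide ht with hm | ⟨a, b, hm, hab, -⟩
      · -- only the first `μ(r)` moves are placements
        have hlt : t < mu hT r := by
          by_contra! hge
          have hmem : S[t] ∈ (σ.sort (outDarts T r)).reverse.flatMap
              fun d => moveAlong hT σ d (label hT d) := by
            simp only [hS, searchFrom]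
            rw [List.getElem_append_right (by simpa using hge)]
            exact List.getElem_mem _
          obtain ⟨e, -, he⟩ := List.mem_flatMap.1 hmem
          obtain ⟨a, b, hab⟩ := exists_eq_slide_of_mem_moveAlong hT σ e he
          rw [hm] at hab
          simp at hab
        rw [sn, occ_succ ht, hm, sum_apply_place]
        rw [sn] at ih
        omega
      · rw [hm] at hl
        rw [sn, occ_succ ht, hm, sum_apply_slide hab.ne hl.2]
        rw [sn] at ih
        omega
  refine Finset.sup_le fun t ht => (key t ?_).trans (min_le_right _ _)
  simpa [Nat.lt_succ_iff] using ht

variable [Nontrivial V]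

theorem isMinimalIMCNodeClearing_searchFrom (hT : T.IsTree) (σ : Sorter hT) {r : V}
    (hr : ∀ x, mu hT r ≤ mu hT x) : IsMinimalIMCNodeClearing T (searchFrom hT σ r) := by
  have h := (isExploration_searchFrom hT σ r).isIMCNodeClearing
  have hne : {k | ∃ S : List (SearchMove V), IsIMCNodeClearing T S ∧ maxSn S = k}.Nonempty :=
    ⟨_, _, h, rfl⟩
  obtain ⟨S, hS, hk⟩ := Nat.sInf_mem hne
  obtain ⟨x, hx⟩ := hS.exists_mu_le_maxSn hT
  refine ⟨h, le_antisymm ?_ (Nat.sInf_le ⟨_, h, rfl⟩)⟩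
  exact ((maxSn_searchFrom_le hT σ r).trans ((hr x).trans hx)).trans hk.le

theorem isMinimalIMCEdgeClearing_searchFrom (hT : T.IsTree) (σ : Sorter hT) {r : V}
    (hr : ∀ x, mu hT r ≤ mu hT x) : IsMinimalIMCEdgeClearing T (searchFrom hT σ r) := by
  have h := (isExploration_searchFrom hT σ r).isIMCEdgeClearing hT
  have hne : {k | ∃ S : List (SearchMove V), IsIMCEdgeClearing T S ∧ maxSn S = k}.Nonempty :=
    ⟨_, _, h, rfl⟩
  obtain ⟨S, hS, hk⟩ := Nat.sInf_mem hne
  obtain ⟨x, hx⟩ := hS.exists_mu_le_maxSn hT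
  refine ⟨h, le_antisymm ?_ (Nat.sInf_le ⟨_, h, rfl⟩)⟩
  exact ((maxSn_searchFrom_le hT σ r).trans ((hr x).trans hx)).trans hk.le

end Leads

end GraphSearch

theorem mainTheorem3 {V : Type*} [Fintype V] [DecidableEq V] [Nontrivial V]
    (T : SimpleGraph V) [DecidableRel T.Adj] (hT : T.IsTree) :
    (∃ u₀ S, GraphSearch.IsSearchOutput hT u₀ S) ∧
    (∀ u₀ S, GraphSearch.IsSearchOutput hT u₀ S →
      GraphSearch.IsRooted u₀ S ∧
      GraphSearch.IsMinimalIMCEdgeClearing T S ∧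
      GraphSearch.IsMinimalIMCNodeClearing T S) ∧
    GraphSearch.sEimc T = GraphSearch.sNimc T := by
  obtain ⟨u₀, hu₀⟩ := Finite.exists_min (GraphSearch.mu hT)
  obtain ⟨σ⟩ := GraphSearch.exists_sorter hT
  refine ⟨⟨u₀, _, hu₀, σ, rfl⟩, ?_, ?_⟩
  · rintro u _ ⟨hu, σ, rfl⟩
    exact ⟨(GraphSearch.isExploration_searchFrom hT σ u).rooted,
      GraphSearch.isMinimalIMCEdgeClearing_searchFrom hT σ hu,
      GraphSearch.isMinimalIMCNodeClearing_searchFrom hT σ hu⟩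
  · exact (GraphSearch.isMinimalIMCEdgeClearing_searchFrom hT σ hu₀).2.symm.trans
      (GraphSearch.isMinimalIMCNodeClearing_searchFrom hT σ hu₀).2
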